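/- Let $(\Omega,\mu)$ be a $\sigma$-finite measure space with non-atomic $\mu$; functions on $\Omega$ are (classes of) $\mu$-measurable real- or complex-valued functions, and $f^*(t)=\inf\{s\ge 0:\mu(\{|f|>s\})\le t\}$ is the non-increasing rearrangement of $f$. Write $\|\cdot\|_{q,(c,d)}$ for the (quasi-)norm of $L_q(c,d)$, $0<q\le\infty$, with $1/\infty=0$. A positive Lebesgue measurable function $b$ on $(0,\infty)$ is slowly varying ($b\in SV$) if for every $\varepsilon>0$ the function $t^{\varepsilon}b(t)$ is equivalent (up to multiplicative constants) to an increasing function and $t^{-\varepsilon}b(t)$ to a decreasing one. For $0<p,q,r,s\le\infty$ and $a,b,c\in SV$ define the following spaces by finiteness of the indicated quasi-norms: $$\|f\|_{L_{p,q;a}}=\big\|t^{\frac1p-\frac1q}a(t)f^*(t)\big\|_{q,(0,\infty)},\qquad \|f\|_{L^{\mathcal R}_{p,r,b,q,a}}=\Big\|t^{-\frac1r}b(t)\big\|u^{\frac1p-\frac1q}a(u)f^*(u)\big\|_{q,(t,\infty)}\Big\|_{r,(0,\infty)},$$ $$\|f\|_{L^{\mathcal R,\mathcal L}_{p,(s,c,r,b,q,a)}}=\bigg\|t^{-\frac1s}c(t)\Big\|u^{-\frac1r}b(u)\big\|v^{\frac1p-\frac1q}a(v)f^*(v)\big\|_{q,(u,t)}\Big\|_{r,(0,t)}\bigg\|_{s,(0,\infty)},$$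 and let $L^{p),q,r}_{b}=L^{\mathcal R}_{p,r,b,q,1}$ be the grand Lorentz–Karamata space. For a couple $(A_0,A_1)$ of such spaces, $0\le\theta\le1$, $0<q\le\infty$ and $a\in SV$, the space $(A_0,A_1)_{\theta,q;a}$ consists of all $f\in A_0+A_1$ with $\|t^{-\theta-\frac1q}a(t)K(t,f)\|_{q,(0,\infty)}<\infty$, where $K(t,f)=\inf\{\|f_0\|_{A_0}+t\|f_1\|_{A_1}: f=f_0+f_1,\ f_i\in A_i\}$. Equality of spaces means equality as sets with equivalence of quasi-norms. Let $0<p_0<\infty$, $0<r,r_0,q_0\le\infty$ and $a,a_0,b_0\in SV$, with $\|u^{-1/r_0}b_0(u)\|_{r_0,(0,1)}<\infty$. Let $\chi(t)=a_0(t)\|u^{-1/r_0}b_0(u)\|_{r_0,(0,t)}$ and $\rho(t)=t^{1/p_0}\chi(t)$ for $t>0$. (i) If $\|u^{-1/r}a(u)\|_{r,(1,\infty)}<\infty$, then $\big(L^{\mathcal R}_{p_0,r_0,b_0,q_0,a_0},L_\infty\big)_{0,r;a}=L^{\mathcal R,\mathcal L}_{p_0,(r,a\circ\rho,r_0,b_0,q_0,a_0)}$.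 (ii) If $0<\theta<1$, then $\big(L^{\mathcal R}_{p_0,r_0,b_0,q_0,a_0},L_\infty\big)_{\theta,r;a}=L_{p,r;a^\#}$, where $\frac1p=\frac{1-\theta}{p_0}$ and $a^\#=\chi^{1-\theta}\cdot(a\circ\rho)$. (iii) If $\|u^{-1/r}a(u)\|_{r,(0,1)}<\infty$, then $\big(L^{\mathcal R}_{p_0,r_0,b_0,q_0,a_0},L_\infty\big)_{1,r;a}=L_{\infty,r;a\circ\rho}$. Moreover, if $\chi$ is replaced by $\chi(t)=\|u^{-1/r_0}b_0(u)\|_{r_0,(0,t)}$ (and $\rho(t)=t^{1/p_0}\chi(t)$ accordingly), then under the same respective conditions $\big(L^{p_0),q_0,r_0}_{b_0},L_\infty\big)_{\theta,r;a}$ equals $L^{\mathcal R,\mathcal L}_{p_0,(r,a\circ\rho,r_0,b_0,q_0,1)}$ for $\theta=0$, $L_{p,r;a^\#}$ with $\frac1p=\frac{1-\theta}{p_0}$, $a^\#=\chi^{1-\theta}\cdot(a\circ\rho)$ for $0<\theta<1$, and $L_{\infty,r;a\circ\rho}$ for $\theta=1$. -/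

import Mathlib

open MeasureTheory Set
open scoped ENNReal NNReal

noncomputable section

namespace LorentzKaramata

/-- The Lebesgue (quasi-)norm `‖g‖_{q, s}` of a `[0, ∞]`-valued function on a set `s` of reals. -/
def lqNorm (q : ℝ≥0∞) (s : Set ℝ) (g : ℝ → ℝ≥0∞) : ℝ≥0∞ :=
  eLpNorm g q (volume.restrict s)

/-- The real number `1 / q` for `0 < q ≤ ∞`, with `1 / ∞ = 0`. -/
def recip (q : ℝ≥0∞) : ℝ := (q⁻¹).toReal

/-- The power weight `t ^ α * b t`, as an extended nonnegative number. -/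
def weight (α : ℝ) (b : ℝ → ℝ) (t : ℝ) : ℝ≥0∞ := ENNReal.ofReal (t ^ α * b t)

/-- Equivalence `f ≈ g` of functions on `(0, ∞)`. -/
def EquivOn (f g : ℝ → ℝ) : Prop :=
  ∃ C : ℝ, 0 < C ∧ ∀ t : ℝ, 0 < t → f t ≤ C * g t ∧ g t ≤ C * f t

/-- Slowly varying functions on `(0, ∞)`; the values of `b` outside `(0, ∞)` are irrelevant. -/
structure SlowlyVarying (b : ℝ → ℝ) : Prop where
  measurable : AEMeasurable b (volume.restrict (Ioi 0))
  pos : ∀ t : ℝ, 0 < t → 0 < b t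
  equiv_increasing : ∀ ε : ℝ, 0 < ε →
    ∃ g : ℝ → ℝ, MonotoneOn g (Ioi 0) ∧ EquivOn (fun t => t ^ ε * b t) g
  equiv_decreasing : ∀ ε : ℝ, 0 < ε →
    ∃ g : ℝ → ℝ, AntitoneOn g (Ioi 0) ∧ EquivOn (fun t => t ^ (-ε) * b t) g

/-- A measure without atoms: every measurable set of positive measure has a measurable subset of
strictly smaller positive measure. -/
def NonAtomic {Ω : Type*} [MeasurableSpace Ω] (μ : Measure Ω) : Prop :=
  ∀ A : Set Ω, MeasurableSet A → 0 < μ A →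
    ∃ B : Set Ω, B ⊆ A ∧ MeasurableSet B ∧ 0 < μ B ∧ μ B < μ A

section Spaces

variable {Ω : Type*} [MeasurableSpace Ω] {μ : Measure Ω} {𝕜 : Type*} [RCLike 𝕜]

/-- The non-increasing rearrangement
`f^*(t) = inf {s ≥ 0 : μ {x : |f x| > s} ≤ t}` (the infimum of no finite `s` being `∞`). -/
def rearr (f : Ω →ₘ[μ] 𝕜) (t : ℝ) : ℝ≥0∞ :=
  sInf {s : ℝ≥0∞ | μ {x | s < ‖f x‖ₑ} ≤ ENNReal.ofReal t}

variable (μ 𝕜) in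
/-- A space of (classes of) measurable scalar functions together with its quasi-norm. -/
structure FunSpace where
  carrier : Set (Ω →ₘ[μ] 𝕜)
  qnorm : (Ω →ₘ[μ] 𝕜) → ℝ≥0∞

/-- The space of all measurable functions for which the functional `N` is finite. -/
def FunSpace.ofNorm (N : (Ω →ₘ[μ] 𝕜) → ℝ≥0∞) : FunSpace μ 𝕜 where
  carrier := {f | N f < ∞}
  qnorm := N

/-- Continuous embedding. -/
def FunSpace.Embeds (X Y : FunSpace μ 𝕜) : Prop :=
  X.carrier ⊆ Y.carrier ∧ ∃ C : ℝ≥0, ∀ f ∈ X.carrier, Y.qnorm f ≤ C * X.qnorm f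

/-- Equality of spaces: they have the same elements, with equivalent quasi-norms. -/
def FunSpace.Same (X Y : FunSpace μ 𝕜) : Prop :=
  X.Embeds Y ∧ Y.Embeds X

/-- Peetre's `K`-functional. -/
def Kfun (A₀ A₁ : FunSpace μ 𝕜) (t : ℝ) (f : Ω →ₘ[μ] 𝕜) : ℝ≥0∞ :=
  ⨅ (f₀ ∈ A₀.carrier) (f₁ ∈ A₁.carrier) (_ : f = f₀ + f₁),
    A₀.qnorm f₀ + ENNReal.ofReal t * A₁.qnorm f₁

/-- The quasi-norm `‖t^{-θ-1/q} a(t) K(t,f)‖_{q,(0,∞)}`. -/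
def interpNorm (A₀ A₁ : FunSpace μ 𝕜) (θ : ℝ) (q : ℝ≥0∞) (a : ℝ → ℝ) (f : Ω →ₘ[μ] 𝕜) : ℝ≥0∞ :=
  lqNorm q (Ioi 0) fun t => weight (-θ - recip q) a t * Kfun A₀ A₁ t f

/-- The real interpolation space `(A₀, A₁)_{θ,q;a}`. -/
def interp (A₀ A₁ : FunSpace μ 𝕜) (θ : ℝ) (q : ℝ≥0∞) (a : ℝ → ℝ) : FunSpace μ 𝕜 where
  carrier := {f | (∃ f₀ ∈ A₀.carrier, ∃ f₁ ∈ A₁.carrier, f = f₀ + f₁) ∧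
    interpNorm A₀ A₁ θ q a f < ∞}
  qnorm := interpNorm A₀ A₁ θ q a

variable (μ 𝕜)

/-- `L_∞`. -/
def Linf : FunSpace μ 𝕜 := .ofNorm fun f => eLpNorm f ∞ μ

/-- The Lorentz–Karamata space `L_{p,q;a}`. -/
def LK (p q : ℝ≥0∞) (a : ℝ → ℝ) : FunSpace μ 𝕜 := .ofNorm fun f =>
  lqNorm q (Ioi 0) fun t => weight (recip p - recip q) a t * rearr f t

/-- The `𝓡` Lorentz–Karamata space `L^𝓡_{p,r,b,q,a}`. -/
def LR (p r : ℝ≥0∞) (b : ℝ → ℝ) (q : ℝ≥0∞) (a : ℝ → ℝ) : FunSpace μ 𝕜 := .ofNorm fun f =>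
  lqNorm r (Ioi 0) fun t => weight (-recip r) b t *
    lqNorm q (Ioi t) fun u => weight (recip p - recip q) a u * rearr f u

/-- The `𝓡𝓛` Lorentz–Karamata space `L^{𝓡,𝓛}_{p,(s,c,r,b,q,a)}`. -/
def LRL (p s : ℝ≥0∞) (c : ℝ → ℝ) (r : ℝ≥0∞) (b : ℝ → ℝ) (q : ℝ≥0∞) (a : ℝ → ℝ) :
    FunSpace μ 𝕜 := .ofNorm fun f =>
  lqNorm s (Ioi 0) fun t => weight (-recip s) c t *
    lqNorm r (Ioo 0 t) fun u => weight (-recip r) b u *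
      lqNorm q (Ioo u t) fun v => weight (recip p - recip q) a v * rearr f v

/-- The grand Lorentz–Karamata space `L^{p),q,r}_b`. -/
def grandLK (p q r : ℝ≥0∞) (b : ℝ → ℝ) : FunSpace μ 𝕜 := .ofNorm fun f =>
  lqNorm r (Ioi 0) fun t => weight (-recip r) b t *
    lqNorm q (Ioi t) fun u => ENNReal.ofReal (u ^ (recip p - recip q)) * rearr f u

end Spaces

/-- `‖u^{-1/r} b(u)‖_{r,(0,t)}` as a real number (it is used only where this is finite). -/
def headNorm (r : ℝ≥0∞) (b : ℝ → ℝ) (t : ℝ) : ℝ :=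
  (lqNorm r (Ioo 0 t) (weight (-recip r) b)).toReal

/-- `χ(t) = a(t) ‖u^{-1/r} b(u)‖_{r,(0,t)}`. -/
def chi (r : ℝ≥0∞) (b a : ℝ → ℝ) (t : ℝ) : ℝ := a t * headNorm r b t

/-- `ρ(t) = t^{1/p} χ(t)`. -/
def rho (p : ℝ≥0∞) (χ : ℝ → ℝ) (t : ℝ) : ℝ := t ^ recip p * χ t

end LorentzKaramata

end

/-!
Under `t = e ^ x` all the norms become Lebesgue norms on the line, and a slowly varying weight
becomes a function whose logarithm is Lipschitz with arbitrarily small constant, up to an additive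
error. Cutting `f` at the level `f^*(t)` bounds `K(ρ(t), f)` by the `𝓡` norm of `f^*` truncated to
`(0, t)`. Conversely that truncated norm is at most the `𝓡` norm of `f₀` plus `ρ(t) ‖f₁‖_∞`, up to
constants, since `(f₀ + f₁)^* ≤ f₀^* + ‖f₁‖_∞` and `ρ(t)` is comparable to the truncated norm of the
constant `1`. Hence `K(ρ(t), f)` is comparable to the truncated norm. In the logarithmic variable
`ρ` has linear growth up to an additive error, so the substitution `t ↦ ρ(t)` in the interpolation
norm costs only constants; this is the case `θ = 0`. For `θ > 0` the outer weight decays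
exponentially, and a Hardy inequality replaces the truncated norm by `ρ(t) f^*(t)`.
-/

noncomputable section

namespace LorentzKaramata

section Dominated

variable {ι κ α : Type*} {F G H F' G' : ι → ℝ≥0∞}

/-- Domination of `F` by `G` up to a finite constant, uniformly in the index. Inequalities that are
uniform in a function and a point are stated over a product index. -/
def Dominated (F G : ι → ℝ≥0∞) : Prop := ∃ C : ℝ≥0, ∀ i, F i ≤ C * G i

infix:50 " ≲ " => Dominated

/-- Equivalence of `F` and `G` up to finite constants, uniformly in the index. -/
def Comparable (F G : ι → ℝ≥0∞) : Prop := F ≲ G ∧ G ≲ F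

infix:50 " ≂ " => Comparable

lemma dominated_of_le_mul {k : ℝ≥0∞} (hk : k ≠ ∞) (h : ∀ i, F i ≤ k * G i) : F ≲ G :=
  ⟨k.toNNReal, fun i => by simpa only [ENNReal.coe_toNNReal hk] using h i⟩

lemma dominated_of_le (h : ∀ i, F i ≤ G i) : F ≲ G :=
  ⟨1, fun i => by simpa using h i⟩

lemma dominated_of_forall_ne_top (C : ℝ≥0) (h : ∀ i, G i ≠ ∞ → F i ≤ C * G i) : F ≲ G := by
  refine ⟨max C 1, fun i => ?_⟩
  by_cases hi : G i = ∞
  · simp [hi, ENNReal.mul_top]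
  · exact (h i hi).trans (by gcongr; exact le_max_left _ _)

namespace Dominated

lemma trans (h : F ≲ G) (h' : G ≲ H) : F ≲ H := by
  obtain ⟨C, hC⟩ := h
  obtain ⟨D, hD⟩ := h'
  refine ⟨C * D, fun i => ?_⟩
  calc F i ≤ C * (D * H i) := (hC i).trans (by gcongr; exact hD i)
    _ = ↑(C * D) * H i := by push_cast; ring

instance : Trans (α := ι → ℝ≥0∞) Dominated Dominated Dominated := ⟨trans⟩

lemma comp (h : F ≲ G) (φ : κ → ι) : (fun j => F (φ j)) ≲ fun j => G (φ j) :=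
  let ⟨C, hC⟩ := h; ⟨C, fun j => hC (φ j)⟩

lemma mul (h : F ≲ G) (h' : F' ≲ G') : (fun i => F i * F' i) ≲ fun i => G i * G' i := by
  obtain ⟨C, hC⟩ := h
  obtain ⟨D, hD⟩ := h'
  refine ⟨C * D, fun i => ?_⟩
  calc F i * F' i ≤ (C * G i) * (D * G' i) := mul_le_mul' (hC i) (hD i)
    _ = ↑(C * D) * (G i * G' i) := by push_cast; ring

lemma mul_left (h : F ≲ G) (K : ι → ℝ≥0∞) : (fun i => K i * F i) ≲ fun i => K i * G i :=
  (dominated_of_le fun _ => le_rfl).mul h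

lemma mul_right (h : F ≲ G) (K : ι → ℝ≥0∞) : (fun i => F i * K i) ≲ fun i => G i * K i :=
  h.mul (dominated_of_le fun _ => le_rfl)

lemma add (h : F ≲ G) (h' : F' ≲ G') : (fun i => F i + F' i) ≲ fun i => G i + G' i := by
  obtain ⟨C, hC⟩ := h
  obtain ⟨D, hD⟩ := h'
  refine ⟨max C D, fun i => ?_⟩
  calc F i + F' i ≤ C * G i + D * G' i := add_le_add (hC i) (hD i)
    _ ≤ ↑(max C D) * G i + ↑(max C D) * G' i := by
        gcongr
        · exact le_max_left _ _
        · exact le_max_right _ _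
    _ = ↑(max C D) * (G i + G' i) := (mul_add _ _ _).symm

lemma eLpNorm [MeasurableSpace α] {F G : ι × α → ℝ≥0∞} (h : F ≲ G) (q : ℝ≥0∞)
    (ν : ι → Measure α) :
    (fun i => eLpNorm (fun x => F (i, x)) q (ν i)) ≲
      fun i => eLpNorm (fun x => G (i, x)) q (ν i) := by
  obtain ⟨C, hC⟩ := h
  exact ⟨C, fun i => eLpNorm_le_mul_eLpNorm_of_ae_le_mul' (.of_forall fun x => by
    simpa using hC (i, x)) q⟩

end Dominated

namespace Comparable

lemma symm (h : F ≂ G) : G ≂ F := ⟨h.2, h.1⟩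

lemma trans (h : F ≂ G) (h' : G ≂ H) : F ≂ H := ⟨h.1.trans h'.1, h'.2.trans h.2⟩

lemma mul_left (h : F ≂ G) (K : ι → ℝ≥0∞) : (fun i => K i * F i) ≂ fun i => K i * G i :=
  ⟨h.1.mul_left K, h.2.mul_left K⟩

lemma eLpNorm [MeasurableSpace α] {F G : ι × α → ℝ≥0∞} (h : F ≂ G) (q : ℝ≥0∞)
    (ν : ι → Measure α) :
    (fun i => eLpNorm (fun x => F (i, x)) q (ν i)) ≂
      fun i => eLpNorm (fun x => G (i, x)) q (ν i) :=
  ⟨h.1.eLpNorm q ν, h.2.eLpNorm q ν⟩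

end Comparable

end Dominated

section Exp

/-- The real exponential with values in `[0, ∞]`. -/
def eexp (x : ℝ) : ℝ≥0∞ := ENNReal.ofReal (Real.exp x)

lemma eexp_zero : eexp 0 = 1 := by simp [eexp]

lemma eexp_add (x y : ℝ) : eexp (x + y) = eexp x * eexp y := by
  simp only [eexp, Real.exp_add, ENNReal.ofReal_mul (Real.exp_pos x).le]

lemma eexp_rpow (x y : ℝ) : eexp x ^ y = eexp (x * y) := by
  simp only [eexp, ENNReal.ofReal_rpow_of_pos (Real.exp_pos x), Real.exp_mul]

lemma eexp_le_eexp {x y : ℝ} : eexp x ≤ eexp y ↔ x ≤ y := by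
  rw [eexp, eexp, ENNReal.ofReal_le_ofReal_iff (Real.exp_pos y).le, Real.exp_le_exp]

lemma eexp_le_one {x : ℝ} : eexp x ≤ 1 ↔ x ≤ 0 := by rw [← eexp_zero, eexp_le_eexp]

lemma eexp_ne_zero (x : ℝ) : eexp x ≠ 0 := by simp [eexp, Real.exp_pos]

lemma eexp_ne_top (x : ℝ) : eexp x ≠ ∞ := ENNReal.ofReal_ne_top

lemma tsum_eexp_neg_pow_ne_top {x : ℝ} (hx : 0 < x) : ∑' n : ℕ, eexp (-x) ^ n ≠ ∞ := by
  have eexp_lt_one : eexp (-x) < 1 := by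
    rw [← eexp_zero, ← not_le, eexp_le_eexp]
    linarith
  rw [ENNReal.tsum_geometric]
  exact ENNReal.inv_ne_top.2 (tsub_pos_of_lt eexp_lt_one).ne'

lemma eexp_neg_mul_eexp (x : ℝ) : eexp (-x) * eexp x = 1 := by
  rw [← eexp_add, neg_add_cancel, eexp_zero]

end Exp

section Norms

variable {α : Type*} [MeasurableSpace α] {ν : Measure α} {q : ℝ≥0∞} {f g : α → ℝ≥0∞}

lemma eLpNorm_le_of_ae_le (h : ∀ᵐ x ∂ν, f x ≤ g x) : eLpNorm f q ν ≤ eLpNorm g q ν :=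
  eLpNorm_mono_enorm_ae (by simpa using h)

lemma eLpNorm_le_mul_of_ae_le {k : ℝ≥0∞} (hk : k ≠ ∞) (h : ∀ᵐ x ∂ν, f x ≤ k * g x) :
    eLpNorm f q ν ≤ k * eLpNorm g q ν := by
  lift k to ℝ≥0 using hk
  exact eLpNorm_le_mul_eLpNorm_of_ae_le_mul' (by simpa using h) q

lemma eLpNorm_restrict_mono {s t : Set α} (h : s ⊆ t) :
    eLpNorm f q (ν.restrict s) ≤ eLpNorm f q (ν.restrict t) :=
  eLpNorm_mono_measure f (Measure.restrict_mono h le_rfl)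

lemma le_eLpNorm_of_ae_le {k : ℝ≥0∞} (hq : q ≠ 0) (hν : 1 ≤ ν univ) (h : ∀ᵐ x ∂ν, k ≤ f x) :
    k ≤ eLpNorm f q ν := by
  have hν0 : ν ≠ 0 := by rintro rfl; simp at hν
  have one_le_rpow : 1 ≤ ν univ ^ (1 / q.toReal) := by
    simpa using ENNReal.rpow_le_rpow hν (z := 1 / q.toReal) (by positivity)
  calc k ≤ k * ν univ ^ (1 / q.toReal) := le_mul_of_one_le_right' one_le_rpow
    _ = eLpNorm (fun _ => k) q ν := by rw [eLpNorm_const _ hq hν0, enorm_eq_self]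
    _ ≤ eLpNorm f q ν := eLpNorm_le_of_ae_le h

lemma mul_eLpNorm_le_eLpNorm_mul (hq : q ≠ 0) (hν : 1 ≤ ν univ) (hg : ∀ x, g x ≠ 0) (k : ℝ≥0∞) :
    k * eLpNorm g q ν ≤ eLpNorm (fun x => g x * k) q ν := by
  rcases eq_or_ne k 0 with rfl | hk0
  · simp
  rcases eq_or_ne k ∞ with rfl | hk
  · exact le_top.trans (le_eLpNorm_of_ae_le hq hν (.of_forall fun x => by
      rw [ENNReal.mul_top (hg x)]))
  · rw [ENNReal.mul_le_iff_le_inv hk0 hk]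
    refine eLpNorm_le_mul_of_ae_le (ENNReal.inv_ne_top.2 hk0) (.of_forall fun x => ?_)
    rw [mul_comm (g x), ← mul_assoc, ENNReal.inv_mul_cancel hk0 hk, one_mul]

end Norms

section ExpVariation

variable {ι : Type*} {c d E F : ℝ} {g h : ℝ → ℝ≥0∞}

/-- `g` varies at most exponentially: its logarithm is Lipschitz with constant `E` up to the
additive error `c`. The values `0` and `∞` are allowed, but only for constant functions. -/
structure ExpVariation (c E : ℝ) (g : ℝ → ℝ≥0∞) : Prop where
  rate_nonneg : 0 ≤ E
  le : ∀ x y, g x ≤ eexp (c + E * |x - y|) * g y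

namespace ExpVariation

lemma le_of_abs_sub_le (hg : ExpVariation c E g) {x y D : ℝ} (hxy : |x - y| ≤ D) :
    g x ≤ eexp (c + E * D) * g y := by
  refine (hg.le x y).trans ?_
  have := hg.rate_nonneg
  gcongr
  exact eexp_le_eexp.2 (by gcongr)

lemma mul (hg : ExpVariation c E g) (hh : ExpVariation d F h) :
    ExpVariation (c + d) (E + F) fun x => g x * h x where
  rate_nonneg := add_nonneg hg.rate_nonneg hh.rate_nonneg
  le x y := by
    calc g x * h x ≤ (eexp (c + E * |x - y|) * g y) * (eexp (d + F * |x - y|) * h y) :=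
          mul_le_mul' (hg.le x y) (hh.le x y)
      _ = eexp ((c + E * |x - y|) + (d + F * |x - y|)) * (g y * h y) := by
          rw [mul_mul_mul_comm, ← eexp_add]
      _ = eexp (c + d + (E + F) * |x - y|) * (g y * h y) := by congr 2; ring

lemma comp (hg : ExpVariation c E g) {K D : ℝ} {R : ℝ → ℝ}
    (hK : 0 ≤ K) (hR : ∀ x y, |R x - R y| ≤ K * |x - y| + D) :
    ExpVariation (c + E * D) (E * K) fun x => g (R x) where
  rate_nonneg := mul_nonneg hg.rate_nonneg hK
  le x y := (hg.le_of_abs_sub_le (hR x y)).trans_eq (by congr 2; ring)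

end ExpVariation

lemma expVariation_eexp (α : ℝ) : ExpVariation 0 |α| fun x => eexp (α * x) where
  rate_nonneg := abs_nonneg α
  le x y := by
    rw [← eexp_add, eexp_le_eexp, ← abs_mul]
    linarith [le_abs_self (α * (x - y))]

lemma dominated_comp_of_abs_sub_le {α : Type*} {φ ψ : α → ℝ} {D : ℝ}
    (h : ∀ x, |φ x - ψ x| ≤ D) {Γ : ι → ℝ → ℝ≥0∞} (hΓ : ∀ i, ExpVariation c E (Γ i)) :
    (fun z : ι × α => Γ z.1 (φ z.2)) ≲ fun z => Γ z.1 (ψ z.2) :=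
  dominated_of_le_mul (eexp_ne_top _) fun z => (hΓ z.1).le_of_abs_sub_le (h z.2)

/-- The function constant on each `[n, n + 1)`, `n ∈ ℤ`, that agrees with `g` at integers; a
measurable substitute for a function that need not be measurable. -/
def step {β : Type*} (g : ℝ → β) (x : ℝ) : β := g ⌊x⌋

lemma measurable_step {β : Type*} [MeasurableSpace β] (g : ℝ → β) : Measurable (step g) :=
  (measurable_from_top (f := fun n : ℤ => g n)).comp Int.measurable_floor

lemma abs_floor_sub_le_one (x : ℝ) : |(⌊x⌋ : ℝ) - x| ≤ 1 := by
  rw [abs_le]; constructor <;> linarith [Int.floor_le x, Int.lt_floor_add_one x]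

lemma ExpVariation.step_comparable (hg : ExpVariation c E g) : step g ≂ g := by
  have hfloor (x : ℝ) := abs_floor_sub_le_one x
  exact ⟨dominated_of_le_mul (eexp_ne_top _) fun x => hg.le_of_abs_sub_le (hfloor x),
    dominated_of_le_mul (eexp_ne_top _) fun x =>
      hg.le_of_abs_sub_le (by rw [abs_sub_comm]; exact hfloor x)⟩

lemma ExpVariation.eLpNorm_mul_add_dominated {w : ℝ → ℝ≥0∞} (hw : ExpVariation c E w)
    {F G : ι → ℝ → ℝ≥0∞} (hF : ∀ i, Measurable (F i)) (hG : ∀ i, Measurable (G i)) (q : ℝ≥0∞)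
    (ν : ι → Measure ℝ) :
    (fun i => eLpNorm (fun x => w x * (F i x + G i x)) q (ν i)) ≲
      fun i => eLpNorm (fun x => w x * F i x) q (ν i) + eLpNorm (fun x => w x * G i x) q (ν i) := by
  obtain ⟨step_le, le_step⟩ := hw.step_comparable
  have drop_step (F : ι → ℝ → ℝ≥0∞) :
      (fun i => eLpNorm (fun x => step w x * F i x) q (ν i)) ≲
        fun i => eLpNorm (fun x => w x * F i x) q (ν i) :=
    ((step_le.comp Prod.snd).mul_right fun z => F z.1 z.2).eLpNorm q ν
  calc (fun i => eLpNorm (fun x => w x * (F i x + G i x)) q (ν i))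
      ≲ fun i => eLpNorm (fun x => step w x * (F i x + G i x)) q (ν i) :=
        ((le_step.comp Prod.snd).mul_right fun z => F z.1 z.2 + G z.1 z.2).eLpNorm q ν
    _ ≲ fun i => eLpNorm (fun x => step w x * F i x) q (ν i) +
          eLpNorm (fun x => step w x * G i x) q (ν i) := by
        refine dominated_of_le_mul (ENNReal.LpAddConst_lt_top q).ne fun i => ?_
        refine (eLpNorm_le_of_ae_le (.of_forall fun x => (mul_add _ _ _).le)).trans ?_
        exact eLpNorm_add_le' ((measurable_step w).mul (hF i)).aestronglyMeasurable
          ((measurable_step w).mul (hG i)).aestronglyMeasurable q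
    _ ≲ _ := (drop_step F).add (drop_step G)

/-- Slow variation in the logarithmic variable. -/
structure LogSlowlyVarying (b : ℝ → ℝ≥0∞) : Prop where
  ne_zero : ∀ x, b x ≠ 0
  ne_top : ∀ x, b x ≠ ∞
  variation : ∀ ε : ℝ, 0 < ε → ∃ c : ℝ, ExpVariation c ε b

lemma LogSlowlyVarying.mul {a b : ℝ → ℝ≥0∞} (ha : LogSlowlyVarying a) (hb : LogSlowlyVarying b) :
    LogSlowlyVarying fun x => a x * b x where
  ne_zero x := mul_ne_zero (ha.ne_zero x) (hb.ne_zero x)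
  ne_top x := ENNReal.mul_ne_top (ha.ne_top x) (hb.ne_top x)
  variation ε hε := by
    obtain ⟨c, hc⟩ := ha.variation (ε / 2) (by positivity)
    obtain ⟨d, hd⟩ := hb.variation (ε / 2) (by positivity)
    exact ⟨c + d, by simpa only [add_halves] using hc.mul hd⟩

end ExpVariation

section TruncatedNorm

variable {ι : Type*} {q r : ℝ≥0∞} {b w h h' : ℝ → ℝ≥0∞} {c E δ x : ℝ}

lemma eLpNorm_comp_add_right_Iio (F : ℝ → ℝ≥0∞) (y x : ℝ) :
    eLpNorm (fun u => F (u + y)) q (volume.restrict (Iio x)) =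
      eLpNorm F q (volume.restrict (Iio (x + y))) := by
  have preimage_Iio : (· + y) ⁻¹' Iio (x + y) = Iio x := by ext u; simp
  have eLpNorm_map := (measurableEmbedding_addRight y).eLpNorm_map_measure (g := F) (p := q)
    (μ := volume.restrict ((· + y) ⁻¹' Iio (x + y)))
  rw [← Measure.restrict_map (measurable_add_const y) measurableSet_Iio, map_add_right_eq_self,
    preimage_Iio] at eLpNorm_map
  exact eLpNorm_map.symm

lemma eLpNorm_eexp_Iio_zero_ne_top (hδ : 0 < δ) (q : ℝ≥0∞) :
    eLpNorm (fun v => eexp (δ * v)) q (volume.restrict (Iio 0)) ≠ ∞ := by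
  rcases eq_or_ne q 0 with rfl | hq0
  · simp
  rcases eq_or_ne q ∞ with rfl | hq
  · rw [eLpNorm_exponent_top]
    refine ne_top_of_le_ne_top ENNReal.one_ne_top (eLpNormEssSup_le_of_ae_enorm_bound ?_)
    filter_upwards [ae_restrict_mem measurableSet_Iio] with v hv
    rw [enorm_eq_self, eexp_le_one]
    exact mul_nonpos_of_nonneg_of_nonpos hδ.le (le_of_lt hv)
  · have hq' := ENNReal.toReal_pos hq0 hq
    rw [eLpNorm_eq_lintegral_rpow_enorm_toReal hq0 hq]
    refine ENNReal.rpow_ne_top_of_nonneg (by positivity) ?_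
    have integrable_exp : IntegrableOn (fun x => Real.exp ((δ * q.toReal) * x)) (Iio 0) :=
      (integrableOn_exp_mul_Iic (by positivity) 0).mono_set Iio_subset_Iic_self
    refine ne_top_of_le_ne_top integrable_exp.lintegral_lt_top.ne (lintegral_mono fun x => ?_)
    rw [enorm_eq_self, eexp_rpow, mul_right_comm, eexp]

lemma ExpVariation.eexp_neg_mul_le_eLpNorm_Ioo (hw : ExpVariation c E w) (hh : Antitone h)
    (hq : q ≠ 0) {u : ℝ} (hu : u ≤ x - 1) :
    eexp (-(c + E)) * (w x * h x) ≤
      eLpNorm (fun v => w v * h v) q (volume.restrict (Ioo u x)) := by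
  refine (le_eLpNorm_of_ae_le hq (by simp) ?_).trans
    (eLpNorm_restrict_mono (Ioo_subset_Ioo_left hu))
  filter_upwards [ae_restrict_mem measurableSet_Ioo] with v hv
  have w_le : w x ≤ eexp (c + E) * w v := by
    simpa using hw.le_of_abs_sub_le (D := 1) (x := x) (y := v)
      (by rw [abs_le]; constructor <;> linarith [hv.1, hv.2])
  calc eexp (-(c + E)) * (w x * h x) ≤ eexp (-(c + E)) * (eexp (c + E) * w v * h v) := by
        gcongr; exact hh hv.2.le
    _ = w v * h v := by rw [mul_assoc, ← mul_assoc, eexp_neg_mul_eexp, one_mul]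

/-- The norm of `b` over `(-∞, x)`: in the logarithmic variable, the norm
`‖u^{-1/r} b(u)‖_{r,(0,t)}` that enters `χ`. -/
def logHead (r : ℝ≥0∞) (b : ℝ → ℝ≥0∞) (x : ℝ) : ℝ≥0∞ := eLpNorm b r (volume.restrict (Iio x))

lemma ExpVariation.logHead (hb : ExpVariation c E b) (r : ℝ≥0∞) :
    ExpVariation c E (logHead r b) where
  rate_nonneg := hb.rate_nonneg
  le x y := by
    have translate := eLpNorm_comp_add_right_Iio (q := r) b (x - y) y
    rw [add_sub_cancel] at translate
    rw [LorentzKaramata.logHead, ← translate]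
    exact eLpNorm_le_mul_of_ae_le (eexp_ne_top _) (.of_forall fun u => by
      simpa using hb.le (u + (x - y)) u)

lemma LogSlowlyVarying.logHead (hb : LogSlowlyVarying b) (hr : r ≠ 0)
    (hfin : logHead r b 0 ≠ ∞) : LogSlowlyVarying (logHead r b) where
  ne_zero x h0 := by
    obtain ⟨c, hc⟩ := hb.variation 1 one_pos
    have lower := hc.eexp_neg_mul_le_eLpNorm_Ioo (h := 1) antitone_const hr (le_refl (x - 1))
    simp only [Pi.one_apply, mul_one] at lower
    have upper := lower.trans (eLpNorm_restrict_mono Ioo_subset_Iio_self)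
    rw [← LorentzKaramata.logHead, h0, nonpos_iff_eq_zero] at upper
    exact mul_ne_zero (eexp_ne_zero _) (hb.ne_zero x) upper
  ne_top x := by
    obtain ⟨c, hc⟩ := hb.variation 1 one_pos
    exact ne_top_of_le_ne_top (ENNReal.mul_ne_top (eexp_ne_top _) hfin) ((hc.logHead r).le x 0)
  variation ε hε := (hb.variation ε hε).imp fun _ hc => hc.logHead r

/-- The iterated norm `‖b(u) ‖w h‖_{q,(u,x)}‖_{r,(-∞,x)}`: the inner part of the norm of an `𝓡𝓛`
space in the logarithmic variable. -/
def truncatedNorm (r q : ℝ≥0∞) (b w h : ℝ → ℝ≥0∞) (x : ℝ) : ℝ≥0∞ :=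
  eLpNorm (fun u => b u * eLpNorm (fun v => w v * h v) q (volume.restrict (Ioo u x))) r
    (volume.restrict (Iio x))

/-- The iterated norm `‖b(u) ‖w h‖_{q,(u,∞)}‖_{r,(-∞,∞)}`: the norm of an `𝓡` space in the
logarithmic variable. -/
def fullNorm (r q : ℝ≥0∞) (b w h : ℝ → ℝ≥0∞) : ℝ≥0∞ :=
  eLpNorm (fun u => b u * eLpNorm (fun v => w v * h v) q (volume.restrict (Ioi u))) r volume

lemma truncatedNorm_mono (hh : ∀ v, h v ≤ h' v) :
    truncatedNorm r q b w h x ≤ truncatedNorm r q b w h' x := by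
  refine eLpNorm_le_of_ae_le (.of_forall fun u => ?_)
  gcongr
  refine eLpNorm_le_of_ae_le (.of_forall fun v => ?_)
  gcongr
  exact hh v

lemma truncatedNorm_le_fullNorm (h : ℝ → ℝ≥0∞) (x : ℝ) :
    truncatedNorm r q b w h x ≤ fullNorm r q b w h := by
  refine (eLpNorm_le_of_ae_le (.of_forall fun u => ?_)).trans
    (eLpNorm_mono_measure _ Measure.restrict_le_self)
  gcongr
  exact Ioo_subset_Ioi_self

lemma fullNorm_eq_truncatedNorm (h0 : ∀ v, x ≤ v → h v = 0) :
    fullNorm r q b w h = truncatedNorm r q b w h x := by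
  have inner (u : ℝ) : eLpNorm (fun v => w v * h v) q (volume.restrict (Ioi u)) =
      eLpNorm (fun v => w v * h v) q (volume.restrict (Ioo u x)) := by
    rw [← Iio_inter_Ioi, ← Measure.restrict_restrict measurableSet_Iio]
    refine (eLpNorm_restrict_eq_of_support_subset fun v hv => ?_).symm
    by_contra hvx
    exact hv (by simp [h0 v (not_lt.1 hvx)])
  simp only [fullNorm, truncatedNorm, inner]
  refine (eLpNorm_restrict_eq_of_support_subset fun u hu => ?_).symm
  by_contra hux
  exact hu (by simp [Ioo_eq_empty (mt mem_Iio.2 hux)])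

lemma truncatedNorm_le_of_exp_decay {k : ℝ≥0∞} (hk : k ≠ ∞) (hδ : 0 < δ)
    (hh : ∀ v < x, w v * h v ≤ k * eexp (δ * (v - x))) :
    truncatedNorm r q b w h x ≤
      k * eLpNorm (fun v => eexp (δ * v)) q (volume.restrict (Iio 0)) * logHead r b x := by
  set N := eLpNorm (fun v => eexp (δ * v)) q (volume.restrict (Iio 0))
  have inner (u : ℝ) : eLpNorm (fun v => w v * h v) q (volume.restrict (Ioo u x)) ≤ k * N := by
    calc eLpNorm (fun v => w v * h v) q (volume.restrict (Ioo u x))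
        ≤ k * eLpNorm (fun v => eexp (δ * (v - x))) q (volume.restrict (Ioo u x)) := by
          refine eLpNorm_le_mul_of_ae_le hk ?_
          filter_upwards [ae_restrict_mem measurableSet_Ioo] with v hv using hh v hv.2
      _ ≤ k * eLpNorm (fun v => eexp (δ * (v - x))) q (volume.restrict (Iio x)) := by
          gcongr; exact Ioo_subset_Iio_self
      _ = k * N := by
          simp only [sub_eq_add_neg]
          rw [eLpNorm_comp_add_right_Iio (fun v => eexp (δ * v)), add_neg_cancel]
  refine eLpNorm_le_mul_of_ae_le
    (ENNReal.mul_ne_top hk (eLpNorm_eexp_Iio_zero_ne_top hδ q)) (.of_forall fun u => ?_)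
  rw [mul_comm (b u)]
  gcongr
  exact inner u

lemma truncatedNorm_dominated_iSup (hH : LogSlowlyVarying (logHead r b)) (hδ : 0 < δ)
    (q : ℝ≥0∞) (w : ℝ → ℝ≥0∞) (h : ι → ℝ → ℝ≥0∞) :
    (fun z : ι × ℝ => truncatedNorm r q b w (h z.1) z.2) ≲
      fun z => ⨆ v ∈ Iio z.2, eexp (δ * (z.2 - v)) * (w v * logHead r b v * h z.1 v) := by
  obtain ⟨c, hc⟩ := hH.variation (δ / 2) (by positivity)
  set N := eLpNorm (fun v => eexp (δ / 2 * v)) q (volume.restrict (Iio 0))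
  have hN : N ≠ ∞ := eLpNorm_eexp_Iio_zero_ne_top (by positivity) q
  refine dominated_of_forall_ne_top (eexp c * N).toNNReal fun ⟨i, x⟩ hS => ?_
  rw [ENNReal.coe_toNNReal (ENNReal.mul_ne_top (eexp_ne_top _) hN)]
  dsimp only at hS ⊢
  set S := ⨆ v ∈ Iio x, eexp (δ * (x - v)) * (w v * logHead r b v * h i v)
  set H := logHead r b
  have decay (v : ℝ) (hv : v < x) :
      w v * h i v ≤ (H x)⁻¹ * (eexp c * S) * eexp (δ / 2 * (v - x)) := by
    rw [mul_assoc, ← ENNReal.mul_le_iff_le_inv (hH.ne_zero x) (hH.ne_top x)]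
    have head_le : H x ≤ eexp (c + δ / 2 * (x - v)) * H v := by
      simpa only [abs_of_pos (sub_pos.2 hv)] using hc.le x v
    have split : eexp (c + δ / 2 * (x - v)) =
        eexp c * eexp (δ * (x - v)) * eexp (δ / 2 * (v - x)) := by
      rw [← eexp_add, ← eexp_add]; ring_nf
    calc H x * (w v * h i v) ≤ eexp (c + δ / 2 * (x - v)) * H v * (w v * h i v) := by gcongr
      _ = eexp c * (eexp (δ * (x - v)) * (w v * H v * h i v)) * eexp (δ / 2 * (v - x)) := by
          rw [split]; simp only [mul_assoc, mul_comm, mul_left_comm]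
      _ ≤ eexp c * S * eexp (δ / 2 * (v - x)) := by
          gcongr
          exact le_iSup₂ (f := fun v (_ : v ∈ Iio x) => eexp (δ * (x - v)) * (w v * H v * h i v))
            v hv
  have hk : (H x)⁻¹ * (eexp c * S) ≠ ∞ := ENNReal.mul_ne_top
    (ENNReal.inv_ne_top.2 (hH.ne_zero x)) (ENNReal.mul_ne_top (eexp_ne_top _) hS)
  calc truncatedNorm r q b w (h i) x ≤ (H x)⁻¹ * (eexp c * S) * N * H x :=
        truncatedNorm_le_of_exp_decay hk (by positivity) decay
    _ = (H x)⁻¹ * H x * (eexp c * N * S) := by ring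
    _ = eexp c * N * S := by
        rw [ENNReal.inv_mul_cancel (hH.ne_zero x) (hH.ne_top x), one_mul]

lemma mul_logHead_mul_dominated_truncatedNorm (hr : r ≠ 0) (hq : q ≠ 0)
    (hb : LogSlowlyVarying b) (hw : ExpVariation c E w) {h : ι → ℝ → ℝ≥0∞}
    (hh : ∀ i, Antitone (h i)) :
    (fun z : ι × ℝ => w z.2 * logHead r b z.2 * h z.1 z.2) ≲
      fun z => truncatedNorm r q b w (h z.1) z.2 := by
  obtain ⟨d, hd⟩ := hb.variation 1 one_pos
  refine dominated_of_le_mul (ENNReal.mul_ne_top (eexp_ne_top (c + E)) (eexp_ne_top (d + 1)))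
    fun ⟨i, x⟩ => ?_
  dsimp only
  set k := eexp (-(c + E)) * (w x * h i x) with hk
  have eexp_mul_k : eexp (c + E) * k = w x * h i x := by
    rw [hk, ← mul_assoc, mul_comm (eexp (c + E)), eexp_neg_mul_eexp, one_mul]
  have head_le : logHead r b x ≤ eexp (d + 1) * logHead r b (x - 1) := by
    simpa using (hd.logHead r).le x (x - 1)
  have lower : k * logHead r b (x - 1) ≤ truncatedNorm r q b w (h i) x := by
    calc k * logHead r b (x - 1)
        ≤ eLpNorm (fun u => b u * k) r (volume.restrict (Iio (x - 1))) :=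
          mul_eLpNorm_le_eLpNorm_mul hr (by simp) hb.ne_zero k
      _ ≤ eLpNorm (fun u => b u * eLpNorm (fun v => w v * h i v) q (volume.restrict (Ioo u x))) r
            (volume.restrict (Iio (x - 1))) := by
          refine eLpNorm_le_of_ae_le ?_
          filter_upwards [ae_restrict_mem measurableSet_Iio] with u hu
          gcongr
          exact hw.eexp_neg_mul_le_eLpNorm_Ioo (hh i) hq (le_of_lt hu)
      _ ≤ truncatedNorm r q b w (h i) x := eLpNorm_restrict_mono (Iio_subset_Iio (by linarith))
  calc w x * logHead r b x * h i x
      ≤ w x * (eexp (d + 1) * logHead r b (x - 1)) * h i x := by gcongr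
    _ = eexp (c + E) * eexp (d + 1) * (k * logHead r b (x - 1)) := by
        rw [mul_mul_mul_comm (eexp (c + E)), eexp_mul_k]; ring
    _ ≤ eexp (c + E) * eexp (d + 1) * truncatedNorm r q b w (h i) x := by gcongr

lemma truncatedNorm_add_dominated {d F : ℝ} (hb : ExpVariation d F b) (hw : ExpVariation c E w)
    (r q : ℝ≥0∞) {h h' : ι → ℝ → ℝ≥0∞} (hh : ∀ i, Measurable (h i))
    (hh' : ∀ i, Measurable (h' i)) :
    (fun z : ι × ℝ => truncatedNorm r q b w (fun v => h z.1 v + h' z.1 v) z.2) ≲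
      fun z => truncatedNorm r q b w (h z.1) z.2 + truncatedNorm r q b w (h' z.1) z.2 := by
  have measurable_inner (h : ℝ → ℝ≥0∞) (x : ℝ) :
      Measurable fun u => eLpNorm (fun v => w v * h v) q (volume.restrict (Ioo u x)) :=
    Antitone.measurable fun u u' huu => eLpNorm_restrict_mono (Ioo_subset_Ioo_left huu)
  have inner := (hw.eLpNorm_mul_add_dominated (ι := (ι × ℝ) × ℝ) (fun z => hh z.1.1)
    (fun z => hh' z.1.1) q fun z => volume.restrict (Ioo z.2 z.1.2)).mul_left fun z => b z.2
  exact (inner.eLpNorm r fun z => volume.restrict (Iio z.2)).trans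
    (hb.eLpNorm_mul_add_dominated (ι := ι × ℝ) (fun z => measurable_inner (h z.1) z.2)
      (fun z => measurable_inner (h' z.1) z.2) r fun z => volume.restrict (Iio z.2))

end TruncatedNorm

section LinearGrowth

variable {ι α β γ : Type*} {κ K c d E : ℝ} {R : ℝ → ℝ}

lemma eLpNorm_comp_le_of_measure_fiber_le [MeasurableSpace α] [MeasurableSpace β]
    [Countable γ] [MeasurableSpace γ] [DiscreteMeasurableSpace γ] {μ : Measure α} {ν : Measure β}
    {φ : α → γ} {ψ : β → γ} (hφ : Measurable φ) (hψ : Measurable ψ) {M : ℝ≥0∞} (hM : M ≠ 0)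
    (h : ∀ j, μ (φ ⁻¹' {j}) ≤ M * ν (ψ ⁻¹' {j})) (G : γ → ℝ≥0∞) (q : ℝ≥0∞) :
    eLpNorm (fun x => G (φ x)) q μ ≤
      M ^ (1 / q).toReal * eLpNorm (fun y => G (ψ y)) q ν := by
  have map_le : μ.map φ ≤ M • ν.map ψ := by
    refine Measure.le_iff.2 fun s hs => ?_
    rw [← Measure.tsum_indicator_apply_singleton _ s hs,
      ← Measure.tsum_indicator_apply_singleton _ s hs]
    refine ENNReal.tsum_le_tsum fun j => indicator_le_indicator ?_
    simpa [Measure.map_apply hφ, Measure.map_apply hψ] using h j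
  have hG : Measurable G := .of_discrete
  calc eLpNorm (fun x => G (φ x)) q μ = eLpNorm G q (μ.map φ) :=
        (eLpNorm_map_measure hG.aestronglyMeasurable hφ.aemeasurable).symm
    _ ≤ eLpNorm G q (M • ν.map ψ) := eLpNorm_mono_measure G map_le
    _ = M ^ (1 / q).toReal * eLpNorm G q (ν.map ψ) := by
        rw [eLpNorm_smul_measure_of_ne_zero hM, smul_eq_mul]
    _ = M ^ (1 / q).toReal * eLpNorm (fun y => G (ψ y)) q ν := by
        rw [eLpNorm_map_measure hG.aestronglyMeasurable hψ.aemeasurable]; rfl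

/-- `R` increases at rates between `κ` and `K`, up to the additive error `c`. -/
structure LinearGrowth (κ K c : ℝ) (R : ℝ → ℝ) : Prop where
  rate_pos : 0 < κ
  rate_le : κ ≤ K
  le_sub : ∀ x y, x ≤ y → κ * (y - x) - c ≤ R y - R x
  sub_le : ∀ x y, x ≤ y → R y - R x ≤ K * (y - x) + c

namespace LinearGrowth

lemma error_nonneg (hR : LinearGrowth κ K c R) : 0 ≤ c := by
  simpa using hR.sub_le 0 0 le_rfl

lemma abs_sub_le (hR : LinearGrowth κ K c R) (x y : ℝ) : |R x - R y| ≤ K * |x - y| + c := by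
  wlog hxy : y ≤ x generalizing x y
  · simpa only [abs_sub_comm] using this y x (le_of_not_ge hxy)
  rw [abs_of_nonneg (sub_nonneg.2 hxy), abs_le]
  have := mul_nonneg hR.rate_pos.le (sub_nonneg.2 hxy)
  have := mul_nonneg (hR.rate_pos.le.trans hR.rate_le) (sub_nonneg.2 hxy)
  exact ⟨by linarith [hR.le_sub y x hxy], hR.sub_le y x hxy⟩

protected lemma step (hR : LinearGrowth κ K c R) : LinearGrowth κ K (c + K) (step R) where
  rate_pos := hR.rate_pos
  rate_le := hR.rate_le
  le_sub x y hxy := by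
    have := hR.le_sub ⌊x⌋ ⌊y⌋ (by exact_mod_cast Int.floor_mono hxy)
    have := hR.rate_le
    rw [step, step]
    nlinarith [hR.rate_pos, Int.floor_le x, Int.lt_floor_add_one y]
  sub_le x y hxy := by
    have := hR.sub_le ⌊x⌋ ⌊y⌋ (by exact_mod_cast Int.floor_mono hxy)
    have := hR.rate_le
    rw [step, step]
    nlinarith [hR.rate_pos, Int.floor_le y, Int.lt_floor_add_one x]

lemma volume_floor_le (hR : LinearGrowth κ K c R) {l : ℝ} (hl : 0 < l) (j : ℤ) :
    volume {x | ⌊R x / l⌋ = j} ≤ ENNReal.ofReal ((l + c) / κ) := by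
  refine (Real.volume_le_diam _).trans (Metric.ediam_le fun x hx y hy => ?_)
  rw [edist_dist, Real.dist_eq]
  refine ENNReal.ofReal_le_ofReal ?_
  wlog hxy : y ≤ x generalizing x y
  · simpa only [abs_sub_comm] using this y hy x hx (le_of_not_ge hxy)
  rw [mem_ofPred_eq, Int.floor_eq_iff, le_div_iff₀ hl, div_lt_iff₀ hl] at hx hy
  rw [abs_of_nonneg (sub_nonneg.2 hxy), le_div_iff₀ hR.rate_pos]
  nlinarith [hR.le_sub y x hxy]

lemma exists_int_le_lt (hR : LinearGrowth κ K c R) (m : ℝ) : ∃ n : ℤ, R n ≤ m ∧ m < R (n + 1) := by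
  have hκ := hR.rate_pos
  have bddAbove : ∀ n : ℤ, R n ≤ m → n ≤ ⌈|m + c - R 0| / κ⌉ := fun n hn => by
    rcases le_or_gt n 0 with hn0 | hn0
    · exact hn0.trans (Int.ceil_nonneg (by positivity))
    · have := hR.le_sub 0 n (by exact_mod_cast hn0.le)
      have : (n : ℝ) ≤ |m + c - R 0| / κ := by
        rw [le_div_iff₀ hκ]; linarith [le_abs_self (m + c - R 0)]
      exact_mod_cast this.trans (Int.le_ceil _)
  have nonempty : ∃ n : ℤ, R n ≤ m := by
    refine ⟨-⌈|R 0 + c - m| / κ⌉, ?_⟩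
    have hceil := Int.le_ceil (|R 0 + c - m| / κ)
    rw [div_le_iff₀ hκ] at hceil
    have ceil_nonneg : (0 : ℝ) ≤ ⌈|R 0 + c - m| / κ⌉ := by
      exact_mod_cast Int.ceil_nonneg (by positivity)
    have := hR.le_sub (-⌈|R 0 + c - m| / κ⌉) 0 (by linarith)
    push_cast
    linarith [le_abs_self (R 0 + c - m)]
  obtain ⟨n, hn, hmax⟩ := Int.exists_greatest_of_bdd ⟨_, bddAbove⟩ nonempty
  refine ⟨n, hn, lt_of_not_ge fun h => ?_⟩
  have := hmax (n + 1) (by exact_mod_cast h)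
  omega

lemma one_le_volume_floor_step (hR : LinearGrowth κ K c R) {l : ℝ} (hl : K + c < l) (j : ℤ) :
    1 ≤ volume {x | ⌊step R x / l⌋ = j} := by
  have hl0 : 0 < l := by linarith [hR.rate_pos, hR.rate_le, hR.error_nonneg]
  obtain ⟨n, hn, hn'⟩ := hR.exists_int_le_lt (j * l)
  have hsub := hR.sub_le n (n + 1) (by linarith)
  calc (1 : ℝ≥0∞) = volume (Ico ((n : ℝ) + 1) (n + 1 + 1)) := by simp
    _ ≤ volume {x | ⌊step R x / l⌋ = j} := by
        refine measure_mono fun x hx => ?_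
        have hfloor : ⌊x⌋ = n + 1 := by
          rw [Int.floor_eq_iff]; push_cast; exact hx
        rw [mem_ofPred_eq, Int.floor_eq_iff, le_div_iff₀ hl0, div_lt_iff₀ hl0,
          step, hfloor]
        push_cast
        constructor <;> linarith

end LinearGrowth

/-- Cutting the line into the cells where `⌊φ / l⌋`, respectively `⌊ψ / l⌋`, is constant reduces the
inequality to a comparison of the measures of the cells. -/
lemma eLpNorm_comp_dominated_of_volume_floor_le {φ ψ φ' ψ' : ℝ → ℝ} {D l : ℝ} {M : ℝ≥0∞}
    (hφ : ∀ x, |φ x - φ' x| ≤ D) (hψ : ∀ x, |ψ x - ψ' x| ≤ D)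
    (hφ' : Measurable φ') (hψ' : Measurable ψ') (hl : 0 < l) (hM : M ≠ 0) (hM' : M ≠ ∞)
    (h : ∀ j : ℤ, volume {x | ⌊φ' x / l⌋ = j} ≤ M * volume {x | ⌊ψ' x / l⌋ = j})
    {Γ : ι → ℝ → ℝ≥0∞} (hΓ : ∀ i, ExpVariation d E (Γ i)) (q : ℝ≥0∞) :
    (fun i => eLpNorm (fun x => Γ i (φ x)) q volume) ≲
      fun i => eLpNorm (fun x => Γ i (ψ x)) q volume := by
  have cut {φ φ' : ℝ → ℝ} (hφ : ∀ x, |φ x - φ' x| ≤ D) :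
      (fun i => eLpNorm (fun x => Γ i (φ x)) q volume) ≂
        fun i => eLpNorm (fun x => Γ i (l * ⌊φ' x / l⌋)) q volume := by
    have abs_sub_le (x : ℝ) : |φ x - l * ⌊φ' x / l⌋| ≤ D + l := by
      have h1 := Int.floor_le (φ' x / l)
      have h2 := Int.lt_floor_add_one (φ' x / l)
      rw [le_div_iff₀ hl] at h1
      rw [div_lt_iff₀ hl] at h2
      have := abs_le.1 (hφ x)
      rw [abs_le]; constructor <;> linarith
    exact Comparable.eLpNorm ⟨dominated_comp_of_abs_sub_le abs_sub_le hΓ,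
      dominated_comp_of_abs_sub_le (fun x => (abs_sub_comm _ _).trans_le (abs_sub_le x)) hΓ⟩
      q fun _ => volume
  have cells_dominated : (fun i => eLpNorm (fun x => Γ i (l * ⌊φ' x / l⌋)) q volume) ≲
      fun i => eLpNorm (fun x => Γ i (l * ⌊ψ' x / l⌋)) q volume := by
    refine dominated_of_le_mul (k := M ^ (1 / q).toReal)
      (ENNReal.rpow_ne_top_of_nonneg ENNReal.toReal_nonneg hM') fun i => ?_
    exact eLpNorm_comp_le_of_measure_fiber_le (hφ'.div_const l).floor (hψ'.div_const l).floor
      hM h (fun j => Γ i (l * j)) q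
  exact ((cut hφ).1.trans cells_dominated).trans (cut hψ).2

lemma LinearGrowth.eLpNorm_comp_comparable (hR : LinearGrowth κ K c R) {Γ : ι → ℝ → ℝ≥0∞}
    (hΓ : ∀ i, ExpVariation d E (Γ i)) (q : ℝ≥0∞) :
    (fun i => eLpNorm (fun x => Γ i (R x)) q volume) ≂ fun i => eLpNorm (Γ i) q volume := by
  have hc := hR.error_nonneg
  have hK := hR.rate_pos.trans_le hR.rate_le
  set l := K + c + 1
  have hl0 : 0 < l := by positivity
  have near_step (x : ℝ) : |R x - step R x| ≤ K + c := by
    refine (hR.abs_sub_le x ⌊x⌋).trans ?_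
    have := abs_sub_comm x ⌊x⌋ ▸ abs_floor_sub_le_one x
    nlinarith
  have near_id (x : ℝ) : |x - id x| ≤ K + c := by simpa using add_nonneg hK.le hc
  have volume_id (j : ℤ) : volume {x | ⌊id x / l⌋ = j} = ENNReal.ofReal l := by
    have : {x : ℝ | ⌊id x / l⌋ = j} = Ico (j * l) ((j + 1) * l) := by
      ext x
      simp only [id_eq, mem_ofPred_eq, Int.floor_eq_iff, le_div_iff₀ hl0, div_lt_iff₀ hl0, mem_Ico]
    rw [this, Real.volume_Ico]; congr 1; ring
  have hpos : 0 < (l + (c + K)) / κ := div_pos (by positivity) hR.rate_pos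
  constructor
  · refine eLpNorm_comp_dominated_of_volume_floor_le (M := ENNReal.ofReal ((l + (c + K)) / κ))
      near_step near_id (measurable_step R) measurable_id hl0 (by simpa using hpos)
      ENNReal.ofReal_ne_top (fun j => ?_) hΓ q
    rw [volume_id]
    refine (hR.step.volume_floor_le hl0 j).trans (le_mul_of_one_le_right' ?_)
    rw [ENNReal.one_le_ofReal]; linarith
  · refine eLpNorm_comp_dominated_of_volume_floor_le (M := ENNReal.ofReal l)
      near_id near_step measurable_id (measurable_step R) hl0 (by simpa using hl0)
      ENNReal.ofReal_ne_top (fun j => ?_) hΓ q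
    rw [volume_id]
    exact le_mul_of_one_le_right' (hR.one_le_volume_floor_step (by linarith) j)

end LinearGrowth

section Hardy

variable {ι α : Type*} {κ K c d E F m δ θ : ℝ} {q r : ℝ≥0∞} {a b w W Φ : ℝ → ℝ≥0∞} {R : ℝ → ℝ}

lemma eLpNorm_iSup_dominated_of_geometric [MeasurableSpace α] {μ : Measure α} (hδ : 0 < δ)
    {F : ι → ℕ → α → ℝ≥0∞} (hF : ∀ i n, AEMeasurable (F i n) μ) {N : ι → ℝ≥0∞}
    (h : ∀ i n, eLpNorm (F i n) q μ ≤ eexp (-δ * n) * N i) :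
    (fun i => eLpNorm (fun x => ⨆ n, F i n x) q μ) ≲ N := by
  rcases eq_or_ne q 0 with rfl | hq0
  · exact dominated_of_le (by simp)
  rcases eq_or_ne q ∞ with rfl | hq
  · refine dominated_of_le fun i => ?_
    rw [eLpNorm_exponent_top]
    refine eLpNormEssSup_le_of_ae_enorm_bound ?_
    have ae_le : ∀ᵐ x ∂μ, ∀ n, F i n x ≤ eLpNorm (F i n) ∞ μ := ae_all_iff.2 fun n => by
      rw [eLpNorm_exponent_top]
      exact ae_le_eLpNormEssSup (f := F i n) (μ := μ)
    filter_upwards [ae_le] with x hx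
    rw [enorm_eq_self]
    refine iSup_le fun n => (hx n).trans ((h i n).trans ?_)
    exact mul_le_of_le_one_left' (eexp_le_one.2 (by nlinarith [Nat.cast_nonneg (α := ℝ) n]))
  · have hp := ENNReal.toReal_pos hq0 hq
    set p := q.toReal
    set S := ∑' n : ℕ, eexp (-δ * p) ^ n with hS
    have S_ne_top : S ≠ ∞ := by
      rw [hS, neg_mul]
      exact tsum_eexp_neg_pow_ne_top (mul_pos hδ hp)
    refine dominated_of_le_mul (k := S ^ p⁻¹) (by finiteness) fun i => ?_
    have lintegral_le (n : ℕ) : ∫⁻ x, F i n x ^ p ∂μ ≤ eexp (-δ * p) ^ n * N i ^ p := by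
      have := h i n
      rw [eLpNorm_eq_lintegral_rpow_enorm_toReal hq0 hq, one_div, ENNReal.rpow_inv_le_iff hp,
        ENNReal.mul_rpow_of_nonneg _ _ hp.le, eexp_rpow] at this
      rw [← ENNReal.rpow_natCast, eexp_rpow]
      simpa only [enorm_eq_self, mul_right_comm] using this
    rw [eLpNorm_eq_lintegral_rpow_enorm_toReal hq0 hq, one_div, ENNReal.rpow_inv_le_iff hp,
      ENNReal.mul_rpow_of_nonneg _ _ hp.le, ENNReal.rpow_inv_rpow hp.ne']
    calc ∫⁻ x, ‖⨆ n, F i n x‖ₑ ^ p ∂μ ≤ ∫⁻ x, ∑' n, F i n x ^ p ∂μ := by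
          refine lintegral_mono fun x => ?_
          rw [enorm_eq_self, ← ENNReal.le_rpow_inv_iff hp]
          refine iSup_le fun n => ?_
          rw [ENNReal.le_rpow_inv_iff hp]
          exact ENNReal.le_tsum n
      _ = ∑' n, ∫⁻ x, F i n x ^ p ∂μ := lintegral_tsum fun n => (hF i n).pow_const p
      _ ≤ ∑' n, eexp (-δ * p) ^ n * N i ^ p := ENNReal.tsum_le_tsum lintegral_le
      _ = S * N i ^ p := ENNReal.tsum_mul_right

-- The supremum over `x - v ∈ [n, n + 1)` is controlled by the value at `x - (n + 1)`.
lemma ExpVariation.damped_le_iSup_sample (hΦ : ExpVariation c E Φ) (hδ : 0 < δ) {h : ℝ → ℝ≥0∞}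
    (hh : Antitone h) {x v : ℝ} (hv : v < x) :
    eexp (-δ * (x - v)) * (Φ v * h v) ≤
      eexp (c + E * 2) * ⨆ n : ℕ, eexp (-δ * n) * (step Φ (x - (n + 1)) * h (x - (n + 1))) := by
  set n := ⌊x - v⌋₊
  set s := x - (n + 1)
  have le_sub : n ≤ x - v := Nat.floor_le (sub_pos.2 hv).le
  have sub_lt : x - v < n + 1 := Nat.lt_floor_add_one _
  have near : |v - ⌊s⌋| ≤ 2 := by
    have := abs_le.1 (abs_floor_sub_le_one s)
    rw [abs_le]; constructor <;> linarith
  calc eexp (-δ * (x - v)) * (Φ v * h v)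
      ≤ eexp (-δ * n) * ((eexp (c + E * 2) * step Φ s) * h s) := by
        gcongr
        · exact eexp_le_eexp.2 (by nlinarith)
        · exact hΦ.le_of_abs_sub_le near
        · exact hh (by linarith)
    _ = eexp (c + E * 2) * (eexp (-δ * n) * (step Φ s * h s)) := by ring
    _ ≤ _ := by
        gcongr
        exact le_iSup (fun n : ℕ => eexp (-δ * n) * (step Φ (x - (n + 1)) * h (x - (n + 1)))) n

lemma eLpNorm_iSup_damped_dominated (hδ : 0 < δ) (hΦ : ExpVariation c E Φ)
    {h : ι → ℝ → ℝ≥0∞} (hh : ∀ i, Antitone (h i)) (q : ℝ≥0∞) :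
    (fun i => eLpNorm (fun x => ⨆ v ∈ Iio x, eexp (-δ * (x - v)) * (Φ v * h i v)) q volume) ≲
      fun i => eLpNorm (fun x => Φ x * h i x) q volume := by
  set ψ : ι → ℝ → ℝ≥0∞ := fun i x => step Φ x * h i x
  have measurable_ψ (i : ι) : Measurable (ψ i) := (measurable_step Φ).mul (hh i).measurable
  calc (fun i => eLpNorm (fun x => ⨆ v ∈ Iio x, eexp (-δ * (x - v)) * (Φ v * h i v)) q volume)
      ≲ fun i => eLpNorm (fun x => ⨆ n : ℕ, eexp (-δ * n) * ψ i (x - (n + 1))) q volume :=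
        dominated_of_le_mul (eexp_ne_top (c + E * 2)) fun i =>
          eLpNorm_le_mul_of_ae_le (eexp_ne_top _) (.of_forall fun x =>
            iSup₂_le fun v hv => hΦ.damped_le_iSup_sample hδ (hh i) hv)
    _ ≲ fun i => eLpNorm (ψ i) q volume := by
        refine eLpNorm_iSup_dominated_of_geometric hδ (fun i n => ?_) fun i n => ?_
        · exact ((measurable_ψ i).comp (measurable_id.sub_const _)).const_mul _ |>.aemeasurable
        · refine (eLpNorm_le_mul_of_ae_le (eexp_ne_top _) (.of_forall fun x => le_rfl)).trans_eq ?_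
          rw [← eLpNorm_comp_measurePreserving (measurable_ψ i).aestronglyMeasurable
            (measurePreserving_sub_right volume ((n : ℝ) + 1))]
          rfl
    _ ≲ fun i => eLpNorm (fun x => Φ x * h i x) q volume :=
        ((hΦ.step_comparable.1.comp Prod.snd).mul_right fun z => h z.1 z.2).eLpNorm q
          fun _ => volume

/-- A Hardy inequality: against exponentially decaying weights only the upper end `v = x` of the
iterated norm matters. -/
lemma eLpNorm_mul_truncatedNorm_comparable (hr : r ≠ 0) (hq : q ≠ 0) (hb : LogSlowlyVarying b)
    (hH : LogSlowlyVarying (logHead r b)) (hw : ExpVariation c E w) (hW : ExpVariation d F W)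
    (hδ : 0 < δ) (decay : ∀ v x, v ≤ x → W x ≤ eexp (m - δ * (x - v)) * W v)
    {h : ι → ℝ → ℝ≥0∞} (hh : ∀ i, Antitone (h i)) (p : ℝ≥0∞) :
    (fun i => eLpNorm (fun x => W x * truncatedNorm r q b w (h i) x) p volume) ≂
      fun i => eLpNorm (fun x => W x * (w x * logHead r b x * h i x)) p volume := by
  constructor
  · obtain ⟨e, he⟩ := hH.variation 1 one_pos
    have hΦ := hW.mul (hw.mul he)
    calc (fun i => eLpNorm (fun x => W x * truncatedNorm r q b w (h i) x) p volume)
        ≲ fun i => eLpNorm (fun x => W x * ⨆ v ∈ Iio x,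
            eexp (δ / 2 * (x - v)) * (w v * logHead r b v * h i v)) p volume :=
          ((truncatedNorm_dominated_iSup hH (half_pos hδ) q w h).mul_left fun z => W z.2).eLpNorm p
            fun _ => volume
      _ ≲ fun i => eLpNorm (fun x => ⨆ v ∈ Iio x,
            eexp (-(δ / 2) * (x - v)) * (W v * (w v * logHead r b v) * h i v)) p volume := by
          refine dominated_of_le_mul (eexp_ne_top m) fun i =>
            eLpNorm_le_mul_of_ae_le (eexp_ne_top m) (.of_forall fun x => ?_)
          simp only [ENNReal.mul_iSup]
          refine iSup₂_mono fun v hv => ?_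
          calc W x * (eexp (δ / 2 * (x - v)) * (w v * logHead r b v * h i v))
              ≤ eexp (m - δ * (x - v)) * W v *
                  (eexp (δ / 2 * (x - v)) * (w v * logHead r b v * h i v)) := by
                gcongr; exact decay v x (le_of_lt hv)
            _ = eexp (m - δ * (x - v)) * eexp (δ / 2 * (x - v)) *
                  (W v * (w v * logHead r b v) * h i v) := by ring
            _ = eexp m * (eexp (-(δ / 2) * (x - v)) *
                  (W v * (w v * logHead r b v) * h i v)) := by
                rw [← eexp_add, ← mul_assoc (eexp m), ← eexp_add]; ring_nf
      _ ≲ fun i => eLpNorm (fun x => W x * (w x * logHead r b x) * h i x) p volume :=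
          eLpNorm_iSup_damped_dominated (half_pos hδ) hΦ hh p
      _ ≲ fun i => eLpNorm (fun x => W x * (w x * logHead r b x * h i x)) p volume :=
          dominated_of_le fun i => by simp only [mul_assoc, le_refl]
  · exact ((mul_logHead_mul_dominated_truncatedNorm hr hq hb hw hh).mul_left
      fun z => W z.2).eLpNorm p fun _ => volume

lemma LinearGrowth.exp_decay (hR : LinearGrowth κ K c R) (ha : LogSlowlyVarying a) (hθ : 0 < θ) :
    ∃ m, ∀ v x, v ≤ x → eexp (-θ * R x) * a (R x) ≤
      eexp (m - θ * κ / 2 * (x - v)) * (eexp (-θ * R v) * a (R v)) := by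
  obtain ⟨d, hd⟩ := ha.variation (θ / 2) (by positivity)
  refine ⟨d + 3 / 2 * θ * c, fun v x hvx => ?_⟩
  have growth := hR.le_sub v x hvx
  have := hR.error_nonneg
  have abs_le_add : |R x - R v| ≤ R x - R v + 2 * c := by
    have := mul_nonneg hR.rate_pos.le (sub_nonneg.2 hvx)
    rw [abs_le]; constructor <;> linarith
  calc eexp (-θ * R x) * a (R x)
      ≤ eexp (-θ * R x) * (eexp (d + θ / 2 * |R x - R v|) * a (R v)) := by
        gcongr; exact hd.le _ _
    _ = eexp (-θ * R x + (d + θ / 2 * |R x - R v|)) * a (R v) := by rw [← mul_assoc, ← eexp_add]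
    _ ≤ eexp (d + 3 / 2 * θ * c - θ * κ / 2 * (x - v) + -θ * R v) * a (R v) := by
        gcongr
        exact eexp_le_eexp.2 (by nlinarith)
    _ = _ := by rw [eexp_add _ (-θ * R v), mul_assoc]

lemma truncatedNorm_const_dominated (hH : LogSlowlyVarying (logHead r b))
    (hR : LinearGrowth κ K c R) (hRw : ∀ x, eexp (R x) = w x * logHead r b x) (q : ℝ≥0∞) :
    (fun z : ℝ≥0∞ × ℝ => truncatedNorm r q b w (fun _ => z.1) z.2) ≲
      fun z => eexp (R z.2) * z.1 := by
  refine (truncatedNorm_dominated_iSup hH hR.rate_pos q w fun k _ => k).trans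
    (dominated_of_le_mul (eexp_ne_top c) fun ⟨k, x⟩ => iSup₂_le fun v hv => ?_)
  rw [← hRw, ← mul_assoc, ← mul_assoc, ← eexp_add, ← eexp_add]
  gcongr
  exact eexp_le_eexp.2 (by linarith [hR.le_sub v x (le_of_lt hv)])

end Hardy

section LogVariable

variable {α η : ℝ} {b : ℝ → ℝ} {S : Set ℝ}

lemma exp_image_preimage (h0 : S ⊆ Ioi 0) : Real.exp '' (Real.exp ⁻¹' S) = S := by
  rw [image_preimage_eq_inter_range, Real.range_exp, inter_eq_left.2 h0]

lemma ae_restrict_exp_preimage_iff (hS : MeasurableSet S) (h0 : S ⊆ Ioi 0) {P : ℝ → Prop} :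
    (∀ᵐ x ∂volume.restrict (Real.exp ⁻¹' S), P (Real.exp x)) ↔ ∀ᵐ t ∂volume.restrict S, P t := by
  rw [ae_restrict_iff' hS, ae_restrict_iff' (Real.measurable_exp hS), ae_iff, ae_iff]
  set N := {t | ¬(t ∈ S → P t)}
  have N_pos : N ⊆ Ioi 0 := fun t ht => h0 (Classical.not_imp.1 ht).1
  change volume (Real.exp ⁻¹' N) = 0 ↔ volume N = 0
  constructor <;> intro null
  · rw [← exp_image_preimage N_pos]
    exact addHaar_image_eq_zero_of_differentiableOn_of_addHaar_eq_zero _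
      Real.differentiable_exp.differentiableOn null
  · refine measure_mono_null (t := Real.log '' N) (fun x hx => ⟨_, hx, Real.log_exp x⟩) ?_
    exact addHaar_image_eq_zero_of_differentiableOn_of_addHaar_eq_zero _
      (Real.differentiableOn_log.mono fun t ht => (N_pos ht).ne') null

lemma lqNorm_eq_eLpNorm_comp_exp (q : ℝ≥0∞) (hS : MeasurableSet S) (h0 : S ⊆ Ioi 0)
    (F : ℝ → ℝ≥0∞) :
    lqNorm q S F = eLpNorm (fun x => eexp (recip q * x) * F (Real.exp x)) q
      (volume.restrict (Real.exp ⁻¹' S)) := by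
  rw [lqNorm]
  rcases eq_or_ne q 0 with rfl | hq0
  · simp
  rcases eq_or_ne q ∞ with rfl | hq
  · simp only [recip, ENNReal.inv_top, ENNReal.toReal_zero, zero_mul, eexp_zero, one_mul,
      eLpNorm_exponent_top, eLpNormEssSup, essSup, Filter.limsup_eq, enorm_eq_self]
    exact congrArg sInf (Set.ext fun k =>
      (ae_restrict_exp_preimage_iff hS h0 (P := fun t => F t ≤ k)).symm)
  · have hq' := ENNReal.toReal_pos hq0 hq
    rw [eLpNorm_eq_lintegral_rpow_enorm_toReal hq0 hq,
      eLpNorm_eq_lintegral_rpow_enorm_toReal hq0 hq]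
    nth_rewrite 1 [← exp_image_preimage h0]
    rw [lintegral_image_eq_lintegral_abs_deriv_mul (Real.measurable_exp hS)
      (fun x _ => (Real.hasDerivAt_exp x).hasDerivWithinAt) Real.exp_injective.injOn]
    congr 2 with x
    have recip_mul : recip q * x * q.toReal = x := by
      rw [recip, ENNReal.toReal_inv]; field_simp
    rw [enorm_eq_self, enorm_eq_self, ENNReal.mul_rpow_of_nonneg _ _ hq'.le, eexp_rpow, recip_mul,
      abs_of_pos (Real.exp_pos x), eexp]

/-- A function on `(0, ∞)` in the logarithmic variable. -/
def logLift (b : ℝ → ℝ) (x : ℝ) : ℝ≥0∞ := ENNReal.ofReal (b (Real.exp x))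

/-- The weight `t ^ α * b t` in the logarithmic variable. -/
def logWeight (α : ℝ) (b : ℝ → ℝ) (x : ℝ) : ℝ≥0∞ := eexp (α * x) * logLift b x

@[simp]
lemma logWeight_zero (b : ℝ → ℝ) : logWeight 0 b = logLift b := by
  funext x; rw [logWeight, zero_mul, eexp_zero, one_mul]

lemma weight_exp (α : ℝ) (b : ℝ → ℝ) (x : ℝ) : weight α b (Real.exp x) = logWeight α b x := by
  rw [weight, ENNReal.ofReal_mul (by positivity), ← Real.exp_mul, mul_comm x]; rfl

/-- The shift by `recip q` absorbs the Jacobian: in the logarithmic variable all norms are taken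
with respect to Lebesgue measure. -/
lemma lqNorm_weight_mul (q : ℝ≥0∞) (hS : MeasurableSet S) (h0 : S ⊆ Ioi 0) (α : ℝ) (b : ℝ → ℝ)
    (g : ℝ → ℝ≥0∞) :
    lqNorm q S (fun t => weight (α - recip q) b t * g t) =
      eLpNorm (fun x => logWeight α b x * g (Real.exp x)) q
        (volume.restrict (Real.exp ⁻¹' S)) := by
  rw [lqNorm_eq_eLpNorm_comp_exp q hS h0]
  congr 1 with x
  rw [weight_exp, logWeight, ← mul_assoc, ← mul_assoc, ← eexp_add, ← add_mul, add_sub_cancel,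
    logWeight]

lemma lqNorm_weight_neg_recip_mul (q : ℝ≥0∞) (hS : MeasurableSet S) (h0 : S ⊆ Ioi 0) (b : ℝ → ℝ)
    (g : ℝ → ℝ≥0∞) :
    lqNorm q S (fun t => weight (-recip q) b t * g t) =
      eLpNorm (fun x => logLift b x * g (Real.exp x)) q (volume.restrict (Real.exp ⁻¹' S)) := by
  rw [← zero_sub, lqNorm_weight_mul q hS h0, logWeight_zero]

lemma exp_preimage_Ioo_zero (x : ℝ) : Real.exp ⁻¹' Ioo 0 (Real.exp x) = Iio x := by
  ext u; simp [Real.exp_pos]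

lemma exp_preimage_Ioo (u x : ℝ) : Real.exp ⁻¹' Ioo (Real.exp u) (Real.exp x) = Ioo u x := by
  ext v; simp

lemma exp_preimage_Ioi (u : ℝ) : Real.exp ⁻¹' Ioi (Real.exp u) = Ioi u := by
  ext v; simp

lemma exp_preimage_Ioi_zero : Real.exp ⁻¹' Ioi 0 = univ := by
  ext v; simp [Real.exp_pos]

lemma lqNorm_Ioo_zero_exp (r : ℝ≥0∞) (b : ℝ → ℝ) (x : ℝ) :
    lqNorm r (Ioo 0 (Real.exp x)) (weight (-recip r) b) = logHead r (logLift b) x := by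
  have change_variable := lqNorm_weight_neg_recip_mul r (S := Ioo 0 (Real.exp x))
    measurableSet_Ioo (fun t ht => ht.1) b fun _ => 1
  simp only [mul_one, exp_preimage_Ioo_zero] at change_variable
  exact change_variable

lemma exists_logLift_le_of_equivOn {g : ℝ → ℝ} (h : EquivOn (fun t => t ^ η * b t) g) :
    ∃ c, ∀ x y, g (Real.exp x) ≤ g (Real.exp y) →
      logLift b x ≤ eexp (c + η * (y - x)) * logLift b y := by
  obtain ⟨C, hC, equiv⟩ := h
  refine ⟨Real.log (C * C), fun x y hg => ?_⟩
  have weighted : Real.exp (x * η) * b (Real.exp x) ≤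
      C * C * (Real.exp (y * η) * b (Real.exp y)) := by
    simp only [Real.exp_mul]
    calc Real.exp x ^ η * b (Real.exp x) ≤ C * g (Real.exp x) := (equiv _ (Real.exp_pos x)).1
      _ ≤ C * (C * (Real.exp y ^ η * b (Real.exp y))) := by
          gcongr; exact hg.trans (equiv _ (Real.exp_pos y)).2
      _ = C * C * (Real.exp y ^ η * b (Real.exp y)) := by ring
  rw [logLift, logLift, eexp, ← ENNReal.ofReal_mul (Real.exp_pos _).le]
  refine ENNReal.ofReal_le_ofReal (le_of_mul_le_mul_left (weighted.trans_eq ?_)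
    (Real.exp_pos (x * η)))
  have exp_mul_eq : Real.exp (y * η) = Real.exp (x * η) * Real.exp (η * (y - x)) := by
    rw [← Real.exp_add]; ring_nf
  rw [Real.exp_add, Real.exp_log (by positivity), exp_mul_eq]
  ring

lemma SlowlyVarying.logSlowlyVarying (hb : SlowlyVarying b) : LogSlowlyVarying (logLift b) where
  ne_zero x := by simpa [logLift] using hb.pos _ (Real.exp_pos x)
  ne_top x := ENNReal.ofReal_ne_top
  variation ε hε := by
    obtain ⟨g, hg, equiv_g⟩ := hb.equiv_increasing ε hε
    obtain ⟨g', hg', equiv_g'⟩ := hb.equiv_decreasing ε hε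
    obtain ⟨c, le_right⟩ := exists_logLift_le_of_equivOn equiv_g
    obtain ⟨c', le_left⟩ := exists_logLift_le_of_equivOn equiv_g'
    refine ⟨max c c', hε.le, fun x y => ?_⟩
    rcases le_total x y with hxy | hxy
    · refine (le_right x y (hg (Real.exp_pos x) (Real.exp_pos y) (Real.exp_le_exp.2 hxy))).trans ?_
      rw [abs_of_nonpos (sub_nonpos.2 hxy), neg_sub]
      gcongr
      exact eexp_le_eexp.2 (by gcongr; exact le_max_left _ _)
    · refine (le_left x y (hg' (Real.exp_pos y) (Real.exp_pos x) (Real.exp_le_exp.2 hxy))).trans ?_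
      rw [abs_of_nonneg (sub_nonneg.2 hxy), neg_mul, ← mul_neg, neg_sub]
      gcongr
      exact eexp_le_eexp.2 (by gcongr; exact le_max_right _ _)

lemma LogSlowlyVarying.exists_expVariation_logWeight (hb : LogSlowlyVarying (logLift b)) (α : ℝ) :
    ∃ c E, ExpVariation c E (logWeight α b) := by
  obtain ⟨c, hc⟩ := hb.variation 1 one_pos
  exact ⟨_, _, (expVariation_eexp α).mul hc⟩

lemma slowlyVarying_one : SlowlyVarying fun _ => 1 where
  measurable := measurable_const.aemeasurable
  pos _ _ := one_pos
  equiv_increasing ε hε := by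
    refine ⟨fun t => t ^ ε * 1, fun s hs t _ hst => ?_, 1, one_pos, fun _ _ => by simp⟩
    simpa using Real.rpow_le_rpow (le_of_lt hs) hst hε.le
  equiv_decreasing ε hε := by
    refine ⟨fun t => t ^ (-ε) * 1, fun s hs t _ hst => ?_, 1, one_pos, fun _ _ => by simp⟩
    simpa using Real.rpow_le_rpow_of_nonpos hs hst (neg_nonpos.2 hε.le)

lemma LogSlowlyVarying.exists_linearGrowth {g : ℝ → ℝ≥0∞} (hg : LogSlowlyVarying g) (hα : 0 < α)
    {R : ℝ → ℝ} (hR : ∀ x, eexp (R x) = eexp (α * x) * g x) :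
    ∃ c, LinearGrowth (α / 2) (3 * α / 2) c R := by
  obtain ⟨c, hc⟩ := hg.variation (α / 2) (by positivity)
  have increment_le (x y : ℝ) : R x - R y ≤ α * (x - y) + (c + α / 2 * |x - y|) := by
    suffices eexp (R x) ≤ eexp (α * (x - y) + (c + α / 2 * |x - y|) + R y) by
      linarith [eexp_le_eexp.1 this]
    calc eexp (R x) ≤ eexp (α * x) * (eexp (c + α / 2 * |x - y|) * g y) := by
          rw [hR]; gcongr; exact hc.le x y
      _ = eexp (α * (x - y)) * eexp (c + α / 2 * |x - y|) * (eexp (α * y) * g y) := by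
          rw [show α * x = α * (x - y) + α * y by ring, eexp_add]; ring
      _ = eexp (α * (x - y) + (c + α / 2 * |x - y|) + R y) := by
          rw [← hR, ← eexp_add, ← eexp_add]
  refine ⟨c, by positivity, by linarith, fun x y hxy => ?_, fun x y hxy => ?_⟩
  · have := increment_le x y
    rw [abs_of_nonpos (sub_nonpos.2 hxy)] at this
    linarith
  · have := increment_le y x
    rw [abs_of_nonneg (sub_nonneg.2 hxy)] at this
    linarith

end LogVariable

section Rearrangement

variable {Ω : Type*} [MeasurableSpace Ω] {μ : Measure Ω} {𝕜 : Type*} [RCLike 𝕜]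

lemma rearr_antitone (f : Ω →ₘ[μ] 𝕜) : Antitone (rearr f) := fun _ _ hst =>
  sInf_le_sInf fun _ hs => le_trans hs (ENNReal.ofReal_le_ofReal hst)

lemma measure_rearr_lt_le (f : Ω →ₘ[μ] 𝕜) (t : ℝ) :
    μ {x | rearr f t < ‖f x‖ₑ} ≤ ENNReal.ofReal t := by
  rcases eq_or_ne (rearr f t) ∞ with h | h
  · simp [h]
  obtain ⟨u, u_anti, rearr_lt, u_tendsto⟩ := exists_seq_strictAnti_tendsto' h.lt_top
  have eq_iUnion : {x | rearr f t < ‖f x‖ₑ} = ⋃ n, {x | u n < ‖f x‖ₑ} := by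
    ext x
    simp only [mem_iUnion, mem_ofPred_eq]
    exact ⟨fun hx => (u_tendsto.eventually_lt_const hx).exists,
      fun ⟨n, hn⟩ => (rearr_lt n).1.trans hn⟩
  have monotone : Monotone fun n => {x | u n < ‖f x‖ₑ} := fun m n hmn x hx =>
    (u_anti.antitone hmn).trans_lt hx
  rw [eq_iUnion, monotone.measure_iUnion]
  refine iSup_le fun n => ?_
  obtain ⟨s, hs, hsn⟩ := sInf_lt_iff.1 (rearr_lt n).1
  exact (measure_mono fun x hx => hsn.trans hx).trans hs

lemma rearr_le_of_ae_le {f g : Ω →ₘ[μ] 𝕜} (h : ∀ᵐ x ∂μ, ‖f x‖ₑ ≤ ‖g x‖ₑ) (t : ℝ) :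
    rearr f t ≤ rearr g t := by
  refine sInf_le_sInf fun s hs => le_trans (measure_mono_ae ?_) hs
  filter_upwards [h] with x hx hs using lt_of_lt_of_le hs hx

lemma rearr_add_le (f g : Ω →ₘ[μ] 𝕜) (t : ℝ) :
    rearr (f + g) t ≤ rearr f t + eLpNorm g ∞ μ := by
  refine sInf_le (le_trans (measure_mono_ae ?_) (measure_rearr_lt_le f t))
  rw [eLpNorm_exponent_top]
  filter_upwards [AEEqFun.coeFn_add f g, ae_le_eLpNormEssSup (f := g) (μ := μ)] with x hx hg hlt
  refine lt_of_not_ge fun hf => not_lt.2 ?_ hlt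
  rw [hx, Pi.add_apply]
  exact (enorm_add_le _ _).trans (add_le_add hf hg)

lemma exists_level_decomposition (f : Ω →ₘ[μ] 𝕜) (t : ℝ) :
    ∃ f₀ f₁ : Ω →ₘ[μ] 𝕜, f = f₀ + f₁ ∧ (∀ s, rearr f₀ s ≤ rearr f s) ∧
      (∀ s, t ≤ s → rearr f₀ s = 0) ∧ eLpNorm f₁ ∞ μ ≤ rearr f t := by
  set S := {x | rearr f t < ‖f x‖ₑ}
  have hS : MeasurableSet S := measurableSet_lt measurable_const f.measurable.enorm
  set f₀ : Ω →ₘ[μ] 𝕜 := AEEqFun.mk (S.indicator f) (f.aestronglyMeasurable.indicator hS)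
  set f₁ : Ω →ₘ[μ] 𝕜 := AEEqFun.mk (Sᶜ.indicator f) (f.aestronglyMeasurable.indicator hS.compl)
  have coe_f₀ : f₀ =ᵐ[μ] S.indicator f := AEEqFun.coeFn_mk _ _
  have coe_f₁ : f₁ =ᵐ[μ] Sᶜ.indicator f := AEEqFun.coeFn_mk _ _
  refine ⟨f₀, f₁, AEEqFun.ext ?_, rearr_le_of_ae_le ?_, fun s hs => ?_, ?_⟩
  · filter_upwards [AEEqFun.coeFn_add f₀ f₁, coe_f₀, coe_f₁] with x h h₀ h₁
    rw [h, Pi.add_apply, h₀, h₁, indicator_self_add_compl_apply]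
  · filter_upwards [coe_f₀] with x h₀
    rw [h₀]
    exact enorm_indicator_le_enorm_self _ _
  · refine le_antisymm (sInf_le (le_trans (measure_mono_ae ?_)
      ((measure_rearr_lt_le f t).trans (ENNReal.ofReal_le_ofReal hs)))) zero_le
    filter_upwards [coe_f₀] with x h₀ (hx : 0 < ‖f₀ x‖ₑ)
    rw [h₀] at hx
    exact mem_of_indicator_ne_zero (s := S) (f := f) (enorm_pos.1 hx)
  · rw [eLpNorm_exponent_top]
    refine eLpNormEssSup_le_of_ae_enorm_bound ?_
    filter_upwards [coe_f₁] with x h₁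
    rw [h₁]
    by_cases hx : x ∈ S
    · simp [hx]
    · rw [indicator_of_mem (mem_compl hx)]
      exact not_lt.1 hx

/-- The rearrangement in the logarithmic variable. -/
def logRearr (f : Ω →ₘ[μ] 𝕜) (v : ℝ) : ℝ≥0∞ := rearr f (Real.exp v)

lemma logRearr_antitone (f : Ω →ₘ[μ] 𝕜) : Antitone (logRearr f) :=
  (rearr_antitone f).comp_monotone Real.exp_monotone

end Rearrangement

section Spaces

variable {Ω : Type*} [MeasurableSpace Ω] {μ : Measure Ω} {𝕜 : Type*} [RCLike 𝕜]

variable (μ 𝕜) in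
/-- The `𝓡` space in the logarithmic variable, with arbitrary weights `b` and `w`. -/
def logLR (r q : ℝ≥0∞) (b w : ℝ → ℝ≥0∞) : FunSpace μ 𝕜 :=
  .ofNorm fun f => fullNorm r q b w (logRearr f)

lemma LR_eq_logLR (p r : ℝ≥0∞) (b : ℝ → ℝ) (q : ℝ≥0∞) (a : ℝ → ℝ) :
    LR μ 𝕜 p r b q a = logLR μ 𝕜 r q (logLift b) (logWeight (recip p) a) := by
  rw [LR, logLR]
  congr 1 with f
  rw [lqNorm_weight_neg_recip_mul r measurableSet_Ioi subset_rfl, exp_preimage_Ioi_zero,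
    Measure.restrict_univ, fullNorm]
  congr 2 with u
  rw [lqNorm_weight_mul q measurableSet_Ioi (Ioi_subset_Ioi (Real.exp_pos u).le), exp_preimage_Ioi]
  rfl

lemma grandLK_eq_LR (p q r : ℝ≥0∞) (b : ℝ → ℝ) :
    grandLK μ 𝕜 p q r b = LR μ 𝕜 p r b q fun _ => 1 := by
  simp only [grandLK, LR, weight, mul_one]

lemma LRL_eq (p s : ℝ≥0∞) (c : ℝ → ℝ) (r : ℝ≥0∞) (b : ℝ → ℝ) (q : ℝ≥0∞) (a : ℝ → ℝ) :
    LRL μ 𝕜 p s c r b q a = .ofNorm fun f => eLpNorm (fun x => logLift c x *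
      truncatedNorm r q (logLift b) (logWeight (recip p) a) (logRearr f) x) s volume := by
  rw [LRL]
  congr 1 with f
  rw [lqNorm_weight_neg_recip_mul s measurableSet_Ioi subset_rfl, exp_preimage_Ioi_zero,
    Measure.restrict_univ]
  congr 2 with x
  rw [lqNorm_weight_neg_recip_mul r measurableSet_Ioo (fun t ht => ht.1), exp_preimage_Ioo_zero,
    truncatedNorm]
  congr 3 with u
  rw [lqNorm_weight_mul q measurableSet_Ioo (fun t ht => (Real.exp_pos u).trans ht.1),
    exp_preimage_Ioo]
  rfl

lemma LK_eq (p q : ℝ≥0∞) (a : ℝ → ℝ) :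
    LK μ 𝕜 p q a = .ofNorm fun f =>
      eLpNorm (fun x => logWeight (recip p) a x * logRearr f x) q volume := by
  rw [LK]
  congr 1 with f
  rw [lqNorm_weight_mul q measurableSet_Ioi subset_rfl, exp_preimage_Ioi_zero,
    Measure.restrict_univ]
  rfl

lemma interpNorm_eq (A₀ A₁ : FunSpace μ 𝕜) (θ : ℝ) (q : ℝ≥0∞) (a : ℝ → ℝ) (f : Ω →ₘ[μ] 𝕜) :
    interpNorm A₀ A₁ θ q a f =
      eLpNorm (fun x => logWeight (-θ) a x * Kfun A₀ A₁ (Real.exp x) f) q volume := by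
  rw [interpNorm, lqNorm_weight_mul q measurableSet_Ioi subset_rfl, exp_preimage_Ioi_zero,
    Measure.restrict_univ]

end Spaces

section Kfun

variable {Ω : Type*} [MeasurableSpace Ω] {μ : Measure Ω} {𝕜 : Type*} [RCLike 𝕜]
  {A₀ A₁ : FunSpace μ 𝕜} {f f₀ f₁ : Ω →ₘ[μ] 𝕜} {a : ℝ → ℝ} {θ t : ℝ} {q : ℝ≥0∞}

lemma Kfun_le (h₀ : f₀ ∈ A₀.carrier) (h₁ : f₁ ∈ A₁.carrier) (h : f = f₀ + f₁) :
    Kfun A₀ A₁ t f ≤ A₀.qnorm f₀ + ENNReal.ofReal t * A₁.qnorm f₁ :=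
  iInf₂_le_of_le f₀ h₀ (iInf₂_le_of_le f₁ h₁ (iInf_le _ h))

lemma le_mul_Kfun {k n : ℝ≥0∞} (hk0 : k ≠ 0) (hk : k ≠ ∞)
    (h : ∀ f₀ ∈ A₀.carrier, ∀ f₁ ∈ A₁.carrier, f = f₀ + f₁ →
      n ≤ k * (A₀.qnorm f₀ + ENNReal.ofReal t * A₁.qnorm f₁)) : n ≤ k * Kfun A₀ A₁ t f := by
  rw [← ENNReal.div_le_iff' hk0 hk]
  refine le_iInf₂ fun f₀ h₀ => le_iInf₂ fun f₁ h₁ => le_iInf fun hf => ?_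
  exact (ENNReal.div_le_iff' hk0 hk).2 (h f₀ h₀ f₁ h₁ hf)

lemma expVariation_Kfun (A₀ A₁ : FunSpace μ 𝕜) (f : Ω →ₘ[μ] 𝕜) :
    ExpVariation 0 1 fun x => Kfun A₀ A₁ (Real.exp x) f where
  rate_nonneg := zero_le_one
  le x y := by
    have one_le : 1 ≤ eexp (0 + 1 * |x - y|) := by
      rw [← eexp_zero, eexp_le_eexp]; positivity
    have eexp_le : eexp x ≤ eexp (0 + 1 * |x - y|) * eexp y := by
      rw [← eexp_add, eexp_le_eexp]; linarith [le_abs_self (x - y)]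
    refine le_mul_Kfun (eexp_ne_zero _) (eexp_ne_top _) fun f₀ h₀ f₁ h₁ hf => ?_
    calc Kfun A₀ A₁ (Real.exp x) f ≤ A₀.qnorm f₀ + eexp x * A₁.qnorm f₁ := Kfun_le h₀ h₁ hf
      _ ≤ eexp (0 + 1 * |x - y|) * A₀.qnorm f₀ +
            eexp (0 + 1 * |x - y|) * eexp y * A₁.qnorm f₁ := by
          gcongr; exact le_mul_of_one_le_left' one_le
      _ = eexp (0 + 1 * |x - y|) * (A₀.qnorm f₀ + eexp y * A₁.qnorm f₁) := by ring

lemma exists_decomposition_of_interpNorm_lt_top (hq : q ≠ 0) (ha : ∀ t, 0 < t → 0 < a t)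
    (h : interpNorm A₀ A₁ θ q a f < ∞) : ∃ f₀ ∈ A₀.carrier, ∃ f₁ ∈ A₁.carrier, f = f₀ + f₁ := by
  by_contra hcon
  refine h.not_ge (le_eLpNorm_of_ae_le hq (by simp) ?_)
  filter_upwards [ae_restrict_mem measurableSet_Ioi] with t (ht : 0 < t)
  have Kfun_eq_top : Kfun A₀ A₁ t f = ∞ := by
    simp only [Kfun, iInf_eq_top]
    exact fun f₀ h₀ f₁ h₁ hf => (hcon ⟨f₀, h₀, f₁, h₁, hf⟩).elim
  have weight_ne_zero : weight (-θ - recip q) a t ≠ 0 :=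
    (ENNReal.ofReal_pos.2 (mul_pos (Real.rpow_pos_of_pos ht _) (ha t ht))).ne'
  rw [Kfun_eq_top, ENNReal.mul_top weight_ne_zero]

lemma interp_same_ofNorm (hq : q ≠ 0) (ha : ∀ t, 0 < t → 0 < a t) {N : (Ω →ₘ[μ] 𝕜) → ℝ≥0∞}
    (h : interpNorm A₀ A₁ θ q a ≂ N) : (interp A₀ A₁ θ q a).Same (.ofNorm N) := by
  obtain ⟨⟨C, hC⟩, D, hD⟩ := h
  refine ⟨⟨fun f hf => ?_, D, fun f _ => hD f⟩, fun f hf => ?_, C, fun f _ => hC f⟩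
  · exact (hD f).trans_lt (ENNReal.mul_lt_top ENNReal.coe_lt_top hf.2)
  · have interpNorm_lt_top := (hC f).trans_lt (ENNReal.mul_lt_top ENNReal.coe_lt_top hf)
    exact ⟨exists_decomposition_of_interpNorm_lt_top hq ha interpNorm_lt_top, interpNorm_lt_top⟩

end Kfun

section Couple

variable {Ω : Type*} [MeasurableSpace Ω] {μ : Measure Ω} {𝕜 : Type*} [RCLike 𝕜]
  {q₀ r₀ : ℝ≥0∞} {b w : ℝ → ℝ≥0∞} {κ K c d E : ℝ} {R : ℝ → ℝ}

lemma Kfun_logLR_Linf_dominated (hr₀ : r₀ ≠ 0) (hq₀ : q₀ ≠ 0) (hb : LogSlowlyVarying b)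
    (hw : ExpVariation d E w) (hRw : ∀ x, eexp (R x) = w x * logHead r₀ b x) :
    (fun z : (Ω →ₘ[μ] 𝕜) × ℝ => Kfun (logLR μ 𝕜 r₀ q₀ b w) (Linf μ 𝕜) (Real.exp (R z.2)) z.1) ≲
      fun z => truncatedNorm r₀ q₀ b w (logRearr z.1) z.2 := by
  obtain ⟨C, hC⟩ := mul_logHead_mul_dominated_truncatedNorm hr₀ hq₀ hb hw
    (logRearr_antitone (μ := μ) (𝕜 := 𝕜))
  refine dominated_of_forall_ne_top (1 + C) fun ⟨f, x⟩ finite => ?_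
  have eexp_mul_le := hC (f, x)
  dsimp only at finite eexp_mul_le ⊢
  rw [← hRw] at eexp_mul_le
  have logRearr_ne_top : logRearr f x ≠ ∞ := fun htop => by
    rw [htop, ENNReal.mul_top (eexp_ne_zero _), top_le_iff] at eexp_mul_le
    exact ENNReal.mul_ne_top ENNReal.coe_ne_top finite eexp_mul_le
  obtain ⟨f₀, f₁, hf, f₀_le, f₀_eq_zero, f₁_le⟩ := exists_level_decomposition f (Real.exp x)
  have fullNorm_le : fullNorm r₀ q₀ b w (logRearr f₀) ≤ truncatedNorm r₀ q₀ b w (logRearr f) x := by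
    rw [fullNorm_eq_truncatedNorm (h := logRearr f₀)
      fun v hv => f₀_eq_zero _ (Real.exp_le_exp.2 hv)]
    exact truncatedNorm_mono fun v => f₀_le _
  have mem₀ : f₀ ∈ (logLR μ 𝕜 r₀ q₀ b w).carrier := fullNorm_le.trans_lt finite.lt_top
  have mem₁ : f₁ ∈ (Linf μ 𝕜).carrier := f₁_le.trans_lt logRearr_ne_top.lt_top
  calc Kfun (logLR μ 𝕜 r₀ q₀ b w) (Linf μ 𝕜) (Real.exp (R x)) f
      ≤ fullNorm r₀ q₀ b w (logRearr f₀) + eexp (R x) * eLpNorm f₁ ∞ μ := Kfun_le mem₀ mem₁ hf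
    _ ≤ truncatedNorm r₀ q₀ b w (logRearr f) x + eexp (R x) * logRearr f x := by
        gcongr; exact f₁_le
    _ ≤ truncatedNorm r₀ q₀ b w (logRearr f) x + C * truncatedNorm r₀ q₀ b w (logRearr f) x := by
        gcongr
    _ = ↑(1 + C) * truncatedNorm r₀ q₀ b w (logRearr f) x := by push_cast; ring

lemma truncatedNorm_logRearr_add_dominated (hb : LogSlowlyVarying b)
    (hH : LogSlowlyVarying (logHead r₀ b)) (hw : ExpVariation d E w) (hR : LinearGrowth κ K c R)
    (hRw : ∀ x, eexp (R x) = w x * logHead r₀ b x) (q₀ : ℝ≥0∞) :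
    (fun z : ((Ω →ₘ[μ] 𝕜) × (Ω →ₘ[μ] 𝕜)) × ℝ =>
      truncatedNorm r₀ q₀ b w (logRearr (z.1.1 + z.1.2)) z.2) ≲
      fun z => fullNorm r₀ q₀ b w (logRearr z.1.1) + eexp (R z.2) * eLpNorm z.1.2 ∞ μ := by
  obtain ⟨e, he⟩ := hb.variation 1 one_pos
  have sum_dominated := truncatedNorm_add_dominated he hw r₀ q₀
    (h := fun i : (Ω →ₘ[μ] 𝕜) × (Ω →ₘ[μ] 𝕜) => logRearr i.1)
    (h' := fun i _ => eLpNorm i.2 ∞ μ) (fun i => (logRearr_antitone i.1).measurable)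
    fun _ => measurable_const
  have const_dominated := (truncatedNorm_const_dominated hH hR hRw q₀).comp
    fun z : ((Ω →ₘ[μ] 𝕜) × (Ω →ₘ[μ] 𝕜)) × ℝ => (eLpNorm z.1.2 ∞ μ, z.2)
  refine Dominated.trans (dominated_of_le fun z => ?_) (sum_dominated.trans
    ((dominated_of_le fun z => ?_).add const_dominated))
  · exact truncatedNorm_mono fun v => rearr_add_le z.1.1 z.1.2 _
  · exact truncatedNorm_le_fullNorm (logRearr z.1.1) z.2

lemma Kfun_logLR_Linf_comparable (hr₀ : r₀ ≠ 0) (hq₀ : q₀ ≠ 0) (hb : LogSlowlyVarying b)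
    (hH : LogSlowlyVarying (logHead r₀ b)) (hw : ExpVariation d E w) (hR : LinearGrowth κ K c R)
    (hRw : ∀ x, eexp (R x) = w x * logHead r₀ b x) :
    (fun z : (Ω →ₘ[μ] 𝕜) × ℝ => Kfun (logLR μ 𝕜 r₀ q₀ b w) (Linf μ 𝕜) (Real.exp (R z.2)) z.1) ≂
      fun z => truncatedNorm r₀ q₀ b w (logRearr z.1) z.2 := by
  refine ⟨Kfun_logLR_Linf_dominated hr₀ hq₀ hb hw hRw, ?_⟩
  obtain ⟨C, hC⟩ := truncatedNorm_logRearr_add_dominated (μ := μ) (𝕜 := 𝕜) hb hH hw hR hRw q₀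
  refine dominated_of_le_mul (k := C + 1) (by finiteness) fun ⟨f, x⟩ =>
    le_mul_Kfun (by simp) (by finiteness) fun f₀ _ f₁ _ hf => ?_
  rw [hf]
  exact (hC ((f₀, f₁), x)).trans (mul_le_mul_left le_self_add _)

lemma interpNorm_logLR_Linf_comparable (hr₀ : r₀ ≠ 0) (hq₀ : q₀ ≠ 0) (hb : LogSlowlyVarying b)
    (hH : LogSlowlyVarying (logHead r₀ b)) (hw : ExpVariation d E w) (hR : LinearGrowth κ K c R)
    (hRw : ∀ x, eexp (R x) = w x * logHead r₀ b x) {a : ℝ → ℝ}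
    (ha : LogSlowlyVarying (logLift a)) (θ : ℝ) (r : ℝ≥0∞) :
    interpNorm (logLR μ 𝕜 r₀ q₀ b w) (Linf μ 𝕜) θ r a ≂ fun f => eLpNorm (fun x =>
      logWeight (-θ) a (R x) * truncatedNorm r₀ q₀ b w (logRearr f) x) r volume := by
  obtain ⟨e, F, hW⟩ := ha.exists_expVariation_logWeight (-θ)
  set K : (Ω →ₘ[μ] 𝕜) → ℝ → ℝ≥0∞ := fun f x =>
    Kfun (logLR μ 𝕜 r₀ q₀ b w) (Linf μ 𝕜) (Real.exp x) f
  have change_variable :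
      (fun f => eLpNorm (fun x => logWeight (-θ) a (R x) * K f (R x)) r volume) ≂
        interpNorm (logLR μ 𝕜 r₀ q₀ b w) (Linf μ 𝕜) θ r a := by
    simpa only [← interpNorm_eq] using
      hR.eLpNorm_comp_comparable (fun f => hW.mul (expVariation_Kfun _ _ f)) r
  exact change_variable.symm.trans
    (((Kfun_logLR_Linf_comparable hr₀ hq₀ hb hH hw hR hRw).mul_left
      fun z => logWeight (-θ) a (R z.2)).eLpNorm r fun _ => volume)

end Couple

section FundamentalFunction

variable {p p₀ r : ℝ≥0∞} {a b χ : ℝ → ℝ} {θ : ℝ}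

lemma recip_eq_of_inv_eq (hθ : θ ≤ 1) (h : p⁻¹ = ENNReal.ofReal (1 - θ) / p₀) :
    recip p = (1 - θ) * recip p₀ := by
  rw [recip, recip, h, div_eq_mul_inv, ENNReal.toReal_mul,
    ENNReal.toReal_ofReal (sub_nonneg.2 hθ)]

lemma chi_one (r : ℝ≥0∞) (b : ℝ → ℝ) : chi r b (fun _ => 1) = headNorm r b :=
  funext fun t => one_mul (headNorm r b t)

lemma logSlowlyVarying_logHead_logLift (hb : SlowlyVarying b) (hr : r ≠ 0)
    (hfin : lqNorm r (Ioo 0 1) (weight (-recip r) b) < ∞) :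
    LogSlowlyVarying (logHead r (logLift b)) :=
  hb.logSlowlyVarying.logHead hr (by rw [← lqNorm_Ioo_zero_exp, Real.exp_zero]; exact hfin.ne)

lemma logLift_chi (ha : SlowlyVarying a) (hH : LogSlowlyVarying (logHead r (logLift b))) (x : ℝ) :
    logLift (chi r b a) x = logLift a x * logHead r (logLift b) x := by
  rw [logLift, chi, headNorm, lqNorm_Ioo_zero_exp,
    ENNReal.ofReal_mul (ha.pos _ (Real.exp_pos x)).le, ENNReal.ofReal_toReal (hH.ne_top x), logLift]

lemma logWeight_chi (ha : SlowlyVarying a) (hH : LogSlowlyVarying (logHead r (logLift b)))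
    (α x : ℝ) : logWeight α (chi r b a) x = logWeight α a x * logHead r (logLift b) x := by
  rw [logWeight, logLift_chi ha hH, ← mul_assoc, logWeight]

lemma logSlowlyVarying_logLift_chi (ha : SlowlyVarying a)
    (hH : LogSlowlyVarying (logHead r (logLift b))) : LogSlowlyVarying (logLift (chi r b a)) := by
  rw [funext (logLift_chi ha hH)]
  exact ha.logSlowlyVarying.mul hH

/-- The fundamental function `ρ` with both variables on the logarithmic scale; it is meaningful
for `χ > 0` only. -/
def logRho (p : ℝ≥0∞) (χ : ℝ → ℝ) (x : ℝ) : ℝ := Real.log (rho p χ (Real.exp x))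

lemma LogSlowlyVarying.pos_exp (hχ : LogSlowlyVarying (logLift χ)) (x : ℝ) :
    0 < χ (Real.exp x) :=
  ENNReal.ofReal_pos.1 (pos_iff_ne_zero.2 (hχ.ne_zero x))

lemma rho_exp (p : ℝ≥0∞) (χ : ℝ → ℝ) (x : ℝ) :
    rho p χ (Real.exp x) = Real.exp (recip p * x) * χ (Real.exp x) := by
  rw [rho, ← Real.exp_mul, mul_comm x]

lemma exp_logRho (hχ : LogSlowlyVarying (logLift χ)) (p : ℝ≥0∞) (x : ℝ) :
    Real.exp (logRho p χ x) = rho p χ (Real.exp x) := by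
  refine Real.exp_log ?_
  rw [rho_exp]
  exact mul_pos (Real.exp_pos _) (hχ.pos_exp x)

lemma eexp_logRho (hχ : LogSlowlyVarying (logLift χ)) (p : ℝ≥0∞) (x : ℝ) :
    eexp (logRho p χ x) = logWeight (recip p) χ x := by
  rw [eexp, exp_logRho hχ, rho_exp, ENNReal.ofReal_mul (Real.exp_pos _).le, logWeight, logLift,
    eexp]

lemma exists_linearGrowth_logRho (hχ : LogSlowlyVarying (logLift χ)) (hp : p ≠ 0) (hp' : p ≠ ∞) :
    ∃ c, LinearGrowth (recip p / 2) (3 * recip p / 2) c (logRho p χ) :=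
  hχ.exists_linearGrowth (ENNReal.toReal_pos (by simpa) (by simpa)) (eexp_logRho hχ p)

lemma logLift_logRho (hχ : LogSlowlyVarying (logLift χ)) (p : ℝ≥0∞) (a : ℝ → ℝ) (x : ℝ) :
    logLift a (logRho p χ x) = logLift (a ∘ rho p χ) x := by
  rw [logLift, logLift, exp_logRho hχ, Function.comp_apply]

lemma logWeight_rpow_mul_comp_rho (hχ : LogSlowlyVarying (logLift χ))
    (hp : recip p = (1 - θ) * recip p₀) (a : ℝ → ℝ) (x : ℝ) :
    logWeight (recip p) (fun t => χ t ^ (1 - θ) * a (rho p₀ χ t)) x =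
      logWeight (-θ) a (logRho p₀ χ x) * eexp (logRho p₀ χ x) := by
  have ofReal_rpow : ENNReal.ofReal (χ (Real.exp x) ^ (1 - θ)) =
      eexp (Real.log (χ (Real.exp x)) * (1 - θ)) := by
    rw [Real.rpow_def_of_pos (hχ.pos_exp x), eexp]
  have logRho_eq : logRho p₀ χ x = recip p₀ * x + Real.log (χ (Real.exp x)) := by
    rw [logRho, rho_exp, Real.log_mul (Real.exp_ne_zero _) (hχ.pos_exp x).ne', Real.log_exp]
  rw [logWeight, logLift, ENNReal.ofReal_mul (Real.rpow_nonneg (hχ.pos_exp x).le _), ofReal_rpow,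
    ← exp_logRho hχ, logWeight, mul_right_comm, ← eexp_add, ← mul_assoc, ← eexp_add, logLift, hp,
    logRho_eq]
  ring_nf

end FundamentalFunction

section Interpolation

variable {Ω : Type*} [MeasurableSpace Ω] {μ : Measure Ω} {𝕜 : Type*} [RCLike 𝕜]
  {p p₀ q₀ r r₀ : ℝ≥0∞} {a a₀ b₀ : ℝ → ℝ} {θ : ℝ}

lemma interpNorm_LR_Linf_comparable (hp₀ : p₀ ≠ 0) (hp₀' : p₀ ≠ ∞) (hr₀ : r₀ ≠ 0) (hq₀ : q₀ ≠ 0)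
    (ha : SlowlyVarying a) (ha₀ : SlowlyVarying a₀) (hb₀ : SlowlyVarying b₀)
    (hH : LogSlowlyVarying (logHead r₀ (logLift b₀))) (θ : ℝ) (r : ℝ≥0∞) :
    interpNorm (LR μ 𝕜 p₀ r₀ b₀ q₀ a₀) (Linf μ 𝕜) θ r a ≂ fun f => eLpNorm (fun x =>
      logWeight (-θ) a (logRho p₀ (chi r₀ b₀ a₀) x) *
        truncatedNorm r₀ q₀ (logLift b₀) (logWeight (recip p₀) a₀) (logRearr f) x) r volume := by
  have hχ := logSlowlyVarying_logLift_chi ha₀ hH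
  obtain ⟨c, hR⟩ := exists_linearGrowth_logRho hχ hp₀ hp₀'
  obtain ⟨d, E, hw⟩ := ha₀.logSlowlyVarying.exists_expVariation_logWeight (recip p₀)
  rw [LR_eq_logLR]
  refine interpNorm_logLR_Linf_comparable hr₀ hq₀ hb₀.logSlowlyVarying hH hw hR (fun x => ?_)
    ha.logSlowlyVarying θ r
  rw [eexp_logRho hχ, logWeight_chi ha₀ hH]

theorem interp_zero_LR_Linf_same (hp₀ : p₀ ≠ 0) (hp₀' : p₀ ≠ ∞) (hr : r ≠ 0) (hr₀ : r₀ ≠ 0)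
    (hq₀ : q₀ ≠ 0) (ha : SlowlyVarying a) (ha₀ : SlowlyVarying a₀) (hb₀ : SlowlyVarying b₀)
    (hb₀' : lqNorm r₀ (Ioo 0 1) (weight (-recip r₀) b₀) < ∞) :
    (interp (LR μ 𝕜 p₀ r₀ b₀ q₀ a₀) (Linf μ 𝕜) 0 r a).Same
      (LRL μ 𝕜 p₀ r (a ∘ rho p₀ (chi r₀ b₀ a₀)) r₀ b₀ q₀ a₀) := by
  have hH := logSlowlyVarying_logHead_logLift hb₀ hr₀ hb₀'
  have hχ := logSlowlyVarying_logLift_chi ha₀ hH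
  rw [LRL_eq]
  refine interp_same_ofNorm hr ha.pos ?_
  simpa only [neg_zero, logWeight_zero, logLift_logRho hχ] using
    interpNorm_LR_Linf_comparable (μ := μ) (𝕜 := 𝕜) hp₀ hp₀' hr₀ hq₀ ha ha₀ hb₀ hH 0 r

theorem interp_pos_LR_Linf_same (hp₀ : p₀ ≠ 0) (hp₀' : p₀ ≠ ∞) (hr : r ≠ 0) (hr₀ : r₀ ≠ 0)
    (hq₀ : q₀ ≠ 0) (ha : SlowlyVarying a) (ha₀ : SlowlyVarying a₀) (hb₀ : SlowlyVarying b₀)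
    (hb₀' : lqNorm r₀ (Ioo 0 1) (weight (-recip r₀) b₀) < ∞) (hθ : 0 < θ)
    (hp : recip p = (1 - θ) * recip p₀) :
    (interp (LR μ 𝕜 p₀ r₀ b₀ q₀ a₀) (Linf μ 𝕜) θ r a).Same
      (LK μ 𝕜 p r fun t => chi r₀ b₀ a₀ t ^ (1 - θ) * a (rho p₀ (chi r₀ b₀ a₀) t)) := by
  have hH := logSlowlyVarying_logHead_logLift hb₀ hr₀ hb₀'
  have hχ := logSlowlyVarying_logLift_chi ha₀ hH
  obtain ⟨c, hR⟩ := exists_linearGrowth_logRho hχ hp₀ hp₀'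
  obtain ⟨d, E, hw⟩ := ha₀.logSlowlyVarying.exists_expVariation_logWeight (recip p₀)
  obtain ⟨e, F, hA⟩ := ha.logSlowlyVarying.exists_expVariation_logWeight (-θ)
  obtain ⟨m, decay⟩ := hR.exp_decay ha.logSlowlyVarying hθ
  have hW := hA.comp (hR.rate_pos.le.trans hR.rate_le) hR.abs_sub_le
  have hardy := eLpNorm_mul_truncatedNorm_comparable hr₀ hq₀ hb₀.logSlowlyVarying hH hw hW
    (by have := hR.rate_pos; positivity) decay (logRearr_antitone (μ := μ) (𝕜 := 𝕜)) r
  have LK_integrand (f : Ω →ₘ[μ] 𝕜) (x : ℝ) :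
      logWeight (recip p) (fun t => chi r₀ b₀ a₀ t ^ (1 - θ) * a (rho p₀ (chi r₀ b₀ a₀) t)) x *
          logRearr f x =
        logWeight (-θ) a (logRho p₀ (chi r₀ b₀ a₀) x) *
          (logWeight (recip p₀) a₀ x * logHead r₀ (logLift b₀) x * logRearr f x) := by
    rw [logWeight_rpow_mul_comp_rho hχ hp, eexp_logRho hχ, logWeight_chi ha₀ hH, mul_assoc]
  rw [LK_eq]
  simp only [LK_integrand]
  exact interp_same_ofNorm hr ha.pos
    ((interpNorm_LR_Linf_comparable hp₀ hp₀' hr₀ hq₀ ha ha₀ hb₀ hH θ r).trans hardy)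

theorem interp_one_LR_Linf_same (hp₀ : p₀ ≠ 0) (hp₀' : p₀ ≠ ∞) (hr : r ≠ 0) (hr₀ : r₀ ≠ 0)
    (hq₀ : q₀ ≠ 0) (ha : SlowlyVarying a) (ha₀ : SlowlyVarying a₀) (hb₀ : SlowlyVarying b₀)
    (hb₀' : lqNorm r₀ (Ioo 0 1) (weight (-recip r₀) b₀) < ∞) :
    (interp (LR μ 𝕜 p₀ r₀ b₀ q₀ a₀) (Linf μ 𝕜) 1 r a).Same
      (LK μ 𝕜 ∞ r (a ∘ rho p₀ (chi r₀ b₀ a₀))) := by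
  simpa [Function.comp_def] using interp_pos_LR_Linf_same (μ := μ) (𝕜 := 𝕜) (p := ∞) hp₀ hp₀' hr
    hr₀ hq₀ ha ha₀ hb₀ hb₀' one_pos (by simp [recip])

end Interpolation

end LorentzKaramata

end

open LorentzKaramata in
theorem corollary7p1_general {Ω : Type*} [MeasurableSpace Ω] (μ : Measure Ω) (𝕜 : Type*)
    [RCLike 𝕜] (p₀ r r₀ q₀ : ℝ≥0∞) (hp₀ : 0 < p₀) (hp₀' : p₀ < ∞) (hr : 0 < r) (hr₀ : 0 < r₀)
    (hq₀ : 0 < q₀) (a a₀ b₀ : ℝ → ℝ) (ha : SlowlyVarying a) (ha₀ : SlowlyVarying a₀)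
    (hb₀ : SlowlyVarying b₀) (hb₀' : lqNorm r₀ (Ioo 0 1) (weight (-recip r₀) b₀) < ∞) :
    (∀ χ ρ : ℝ → ℝ, χ = chi r₀ b₀ a₀ → ρ = rho p₀ χ →
      (interp (LR μ 𝕜 p₀ r₀ b₀ q₀ a₀) (Linf μ 𝕜) 0 r a).Same
        (LRL μ 𝕜 p₀ r (a ∘ ρ) r₀ b₀ q₀ a₀) ∧
      (∀ (θ : ℝ) (p : ℝ≥0∞), 0 < θ → θ < 1 → p⁻¹ = ENNReal.ofReal (1 - θ) / p₀ →
        (interp (LR μ 𝕜 p₀ r₀ b₀ q₀ a₀) (Linf μ 𝕜) θ r a).Same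
          (LK μ 𝕜 p r (fun t => χ t ^ (1 - θ) * a (ρ t)))) ∧
      (interp (LR μ 𝕜 p₀ r₀ b₀ q₀ a₀) (Linf μ 𝕜) 1 r a).Same
        (LK μ 𝕜 ∞ r (a ∘ ρ))) ∧
    (∀ χ ρ : ℝ → ℝ, χ = headNorm r₀ b₀ → ρ = rho p₀ χ →
      (interp (grandLK μ 𝕜 p₀ q₀ r₀ b₀) (Linf μ 𝕜) 0 r a).Same
        (LRL μ 𝕜 p₀ r (a ∘ ρ) r₀ b₀ q₀ (fun _ => 1)) ∧
      (∀ (θ : ℝ) (p : ℝ≥0∞), 0 < θ → θ < 1 → p⁻¹ = ENNReal.ofReal (1 - θ) / p₀ →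
        (interp (grandLK μ 𝕜 p₀ q₀ r₀ b₀) (Linf μ 𝕜) θ r a).Same
          (LK μ 𝕜 p r (fun t => χ t ^ (1 - θ) * a (ρ t)))) ∧
      (interp (grandLK μ 𝕜 p₀ q₀ r₀ b₀) (Linf μ 𝕜) 1 r a).Same
        (LK μ 𝕜 ∞ r (a ∘ ρ))) := by
  constructor
  · rintro _ _ rfl rfl
    exact ⟨interp_zero_LR_Linf_same hp₀.ne' hp₀'.ne hr.ne' hr₀.ne' hq₀.ne' ha ha₀ hb₀ hb₀',
      fun θ p hθ hθ' hp => interp_pos_LR_Linf_same hp₀.ne' hp₀'.ne hr.ne' hr₀.ne' hq₀.ne' ha ha₀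
        hb₀ hb₀' hθ (recip_eq_of_inv_eq hθ'.le hp),
      interp_one_LR_Linf_same hp₀.ne' hp₀'.ne hr.ne' hr₀.ne' hq₀.ne' ha ha₀ hb₀ hb₀'⟩
  · rintro _ _ rfl rfl
    have h1 := slowlyVarying_one
    rw [grandLK_eq_LR, ← chi_one]
    exact ⟨interp_zero_LR_Linf_same hp₀.ne' hp₀'.ne hr.ne' hr₀.ne' hq₀.ne' ha h1 hb₀ hb₀',
      fun θ p hθ hθ' hp => interp_pos_LR_Linf_same hp₀.ne' hp₀'.ne hr.ne' hr₀.ne' hq₀.ne' ha h1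
        hb₀ hb₀' hθ (recip_eq_of_inv_eq hθ'.le hp),
      interp_one_LR_Linf_same hp₀.ne' hp₀'.ne hr.ne' hr₀.ne' hq₀.ne' ha h1 hb₀ hb₀'⟩

open LorentzKaramata in
theorem corollary7p1 {Ω : Type*} [MeasurableSpace Ω] (μ : Measure Ω) [SigmaFinite μ]
    (hμ : NonAtomic μ) (𝕜 : Type*) [RCLike 𝕜]
    (p₀ r r₀ q₀ : ℝ≥0∞) (hp₀ : 0 < p₀) (hp₀' : p₀ < ∞) (hr : 0 < r) (hr₀ : 0 < r₀) (hq₀ : 0 < q₀)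
    (a a₀ b₀ : ℝ → ℝ) (ha : SlowlyVarying a) (ha₀ : SlowlyVarying a₀) (hb₀ : SlowlyVarying b₀)
    (hb₀' : lqNorm r₀ (Ioo 0 1) (weight (-recip r₀) b₀) < ∞) :
    -- the couple `(L^𝓡_{p₀,r₀,b₀,q₀,a₀}, L_∞)`
    (∀ χ ρ : ℝ → ℝ, χ = chi r₀ b₀ a₀ → ρ = rho p₀ χ →
      (lqNorm r (Ioi 1) (weight (-recip r) a) < ∞ →
        (interp (LR μ 𝕜 p₀ r₀ b₀ q₀ a₀) (Linf μ 𝕜) 0 r a).Same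
          (LRL μ 𝕜 p₀ r (a ∘ ρ) r₀ b₀ q₀ a₀)) ∧
      (∀ (θ : ℝ) (p : ℝ≥0∞), 0 < θ → θ < 1 → p⁻¹ = ENNReal.ofReal (1 - θ) / p₀ →
        (interp (LR μ 𝕜 p₀ r₀ b₀ q₀ a₀) (Linf μ 𝕜) θ r a).Same
          (LK μ 𝕜 p r (fun t => χ t ^ (1 - θ) * a (ρ t)))) ∧
      (lqNorm r (Ioo 0 1) (weight (-recip r) a) < ∞ →
        (interp (LR μ 𝕜 p₀ r₀ b₀ q₀ a₀) (Linf μ 𝕜) 1 r a).Same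
          (LK μ 𝕜 ∞ r (a ∘ ρ)))) ∧
    -- the couple `(L^{p₀),q₀,r₀}_{b₀}, L_∞)` with the grand Lorentz–Karamata space
    (∀ χ ρ : ℝ → ℝ, χ = headNorm r₀ b₀ → ρ = rho p₀ χ →
      (lqNorm r (Ioi 1) (weight (-recip r) a) < ∞ →
        (interp (grandLK μ 𝕜 p₀ q₀ r₀ b₀) (Linf μ 𝕜) 0 r a).Same
          (LRL μ 𝕜 p₀ r (a ∘ ρ) r₀ b₀ q₀ (fun _ => 1))) ∧
      (∀ (θ : ℝ) (p : ℝ≥0∞), 0 < θ → θ < 1 → p⁻¹ = ENNReal.ofReal (1 - θ) / p₀ →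
        (interp (grandLK μ 𝕜 p₀ q₀ r₀ b₀) (Linf μ 𝕜) θ r a).Same
          (LK μ 𝕜 p r (fun t => χ t ^ (1 - θ) * a (ρ t)))) ∧
      (lqNorm r (Ioo 0 1) (weight (-recip r) a) < ∞ →
        (interp (grandLK μ 𝕜 p₀ q₀ r₀ b₀) (Linf μ 𝕜) 1 r a).Same
          (LK μ 𝕜 ∞ r (a ∘ ρ)))) := by
  obtain ⟨h, h'⟩ := corollary7p1_general μ 𝕜 p₀ r r₀ q₀ hp₀ hp₀' hr hr₀ hq₀ a a₀ b₀ ha ha₀ hb₀ hb₀'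
  exact ⟨fun χ ρ hχ hρ => (h χ ρ hχ hρ).imp (fun H _ => H) (.imp_right fun H _ => H),
    fun χ ρ hχ hρ => (h' χ ρ hχ hρ).imp (fun H _ => H) (.imp_right fun H _ => H)⟩
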